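/- Let $\mathcal H_A,\mathcal H_B$ be complex Hilbert spaces with $\dim\mathcal H_A=2$ and $\dim\mathcal H_B\in\{2,3\}$, and let $\varrho$ be a state on $\mathcal H_A\otimes\mathcal H_B$, i.e. a positive (semidefinite) linear operator of trace one. Call an operator a finite mixture of product states if it has the form $$\sum_{i=1}^k p_i\,\varrho_i\otimes\tilde\varrho_i ,\qquad p_i\ge 0,\quad \sum_{i=1}^k p_i=1,$$ with states $\varrho_i$ on $\mathcal H_A$ and $\tilde\varrho_i$ on $\mathcal H_B$, and call a state separable if it can be approximated arbitrarily well in the trace norm by finite mixtures of product states. Fix any orthonormal bases $(|m\rangle)$ of $\mathcal H_A$ and $(|\mu\rangle)$ of $\mathcal H_B$, and let the partial transpose $\varrho^{T_B}$ be the operator with matrix elements $$\langle m|\otimes\langle\mu|\,\varrho^{T_B}\,|n\rangle\otimes|\nu\rangle=\langle m|\otimes\langle\nu|\,\varrho\,|n\rangle\otimes|\mu\rangle .$$ **Theorem (Peres–Horodecki criterion).** $\varrho$ is separable if and only if $\varrho^{T_B}$ is a positive operator. Likewise, $\varrho$ is itself a finite mixture of product states if and only if $\varrho^{T_B}$ is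 a positive operator. -/

import Mathlib

open scoped TensorProduct

noncomputable section

namespace BipartiteState

/-- A state (density operator): a positive operator of trace one. -/
def IsState {H : Type*} [NormedAddCommGroup H] [InnerProductSpace ℂ H] (ρ : H →ₗ[ℂ] H) : Prop :=
  ρ.IsPositive ∧ LinearMap.trace ℂ H ρ = 1

/-- The trace norm of an operator on a finite-dimensional Hilbert space: the sum of its singular
values (the sequence of singular values has finite support). -/
def traceNorm {H : Type*} [NormedAddCommGroup H] [InnerProductSpace ℂ H] [FiniteDimensional ℂ H]
    (T : H →ₗ[ℂ] H) : ℝ :=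
  T.singularValues.sum fun _ s => s

variable {HA HB : Type*}
  [NormedAddCommGroup HA] [InnerProductSpace ℂ HA]
  [NormedAddCommGroup HB] [InnerProductSpace ℂ HB]

/-- `ρ` is a finite convex combination `∑ i, p i • (σ i ⊗ τ i)` of product states. -/
def IsMixtureOfProductStates (ρ : HA ⊗[ℂ] HB →ₗ[ℂ] HA ⊗[ℂ] HB) : Prop :=
  ∃ (k : ℕ) (p : Fin k → ℝ) (σ : Fin k → HA →ₗ[ℂ] HA) (τ : Fin k → HB →ₗ[ℂ] HB),
    (∀ i, 0 ≤ p i) ∧ ∑ i, p i = 1 ∧ (∀ i, IsState (σ i)) ∧ (∀ i, IsState (τ i)) ∧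
      ρ = ∑ i, (p i : ℂ) • TensorProduct.map (σ i) (τ i)

/-- `ρ` is a separable state: it is a state that can be approximated in the trace norm by finite
convex combinations of product states. -/
def IsSeparable [FiniteDimensional ℂ HA] [FiniteDimensional ℂ HB]
    (ρ : HA ⊗[ℂ] HB →ₗ[ℂ] HA ⊗[ℂ] HB) : Prop :=
  IsState ρ ∧ ∀ ε : ℝ, 0 < ε →
    ∃ ω : HA ⊗[ℂ] HB →ₗ[ℂ] HA ⊗[ℂ] HB, IsMixtureOfProductStates ω ∧ traceNorm (ρ - ω) < ε

variable {ι κ : Type*} [Fintype ι] [Fintype κ] [DecidableEq ι] [DecidableEq κ]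

/-- The matrix elements `⟨m| ⊗ ⟨μ| ρ |n⟩ ⊗ |ν⟩` of an operator in the product of two orthonormal
bases, with row index `(m, μ)` and column index `(n, ν)`. -/
def matrixElements (a : OrthonormalBasis ι ℂ HA) (b : OrthonormalBasis κ ℂ HB)
    (ρ : HA ⊗[ℂ] HB →ₗ[ℂ] HA ⊗[ℂ] HB) : Matrix (ι × κ) (ι × κ) ℂ :=
  Matrix.of fun r c => inner ℂ (a r.1 ⊗ₜ[ℂ] b r.2) (ρ (a c.1 ⊗ₜ[ℂ] b c.2))

/-- The partial transpose of `ρ` with respect to the second tensor factor, in the product of the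
orthonormal bases `a` and `b`: the operator whose `(m, μ), (n, ν)` matrix element is the
`(m, ν), (n, μ)` matrix element of `ρ`. -/
def partialTranspose (a : OrthonormalBasis ι ℂ HA) (b : OrthonormalBasis κ ℂ HB)
    (ρ : HA ⊗[ℂ] HB →ₗ[ℂ] HA ⊗[ℂ] HB) : HA ⊗[ℂ] HB →ₗ[ℂ] HA ⊗[ℂ] HB :=
  Matrix.toLin (a.toBasis.tensorProduct b.toBasis) (a.toBasis.tensorProduct b.toBasis)
    (Matrix.of fun r c => matrixElements a b ρ (r.1, c.2) (c.1, r.2))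

end BipartiteState

end

/-!
# The Peres–Horodecki criterion in dimensions `2 × 2` and `2 × 3`

A partial transpose maps `σ ⊗ τ` to `σ ⊗ τᵀ`, so it maps mixtures of product states to positive
operators; positivity survives limits in the trace norm, because the trace norm controls matrix
elements (`norm_apply_le_traceNorm_mul_norm`).

For the converse, write an operator on `ℂ² ⊗ ℂᴺ`, `N ≤ 3`, as a `2 × 2` block matrix with blocks
`A`, `B`, `Bᴴ`, `D` of size `N`. Partial transposition exchanges `B` and `Bᴴ`. Let `r` and `s` be
the ranks of the matrix and of its partial transpose, both assumed positive semidefinite. Three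
facts show that the matrix is a sum of projections onto product vectors (`IsPPT.mem_sepCone_fin`).

* If `r² + s² > 4 N² + 1`, the matrix is a sum of two PPT matrices with smaller `r + s`
  (`IsPPT.exists_add_eq_of_lt`): the face of the PPT cone around it has dimension at least
  `r² + s² - 4 N² > 1`.
* If `A` is singular, the problem reduces to smaller `N` (`IsPPT.mem_sepCone_of_mulVec_eq_zero`).
* Otherwise one may take `A = 1`. Then `X = D - Bᴴ B` and `Y = D - B Bᴴ` are positive semidefinite
  with equal traces, `r ≥ N + rank X` and `s ≥ N + rank Y`. If `X = 0` then `Y = 0` and `B` is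
  normal, and an eigenbasis of `B` gives the decomposition (`fromBlocks_mem_sepCone_of_normal`). If
  `X` and `Y` are nonzero, the bound on `r² + s²` leaves only `N = 3`, `X = x xᴴ`, `Y = y yᴴ`.

In this last case take the products of the identity `Bᴴ B + x xᴴ = B Bᴴ + y yᴴ` with the identity,
with `B` and with its own terms. The traces of the results show that the triples `(x, y, B x)` and
`(y, x, Bᴴ y)` have complex conjugate Gram matrices (`gram_relations`). As the space has dimension
three, this yields a phase `θ` and a scalar `c` with `Bᴴ y - c̄ y = θ (B x - c x)`
(`exists_sub_smul_eq_smul_sub`), which says that the matrix of size four with blocks `B`, `y`,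
`(θ x)ᴴ`, `c` is normal. The given matrix is a compression of the separable matrix which this normal
dilation defines (`mem_sepCone_of_normal_dilation`).
-/

namespace PPT

open Matrix
open scoped ComplexOrder

/-! ### Block matrices and the partial transpose -/

/-- The partial transpose of a `2 × 2` block matrix in the two-dimensional tensor factor: the blocks
stay intact and the two off-diagonal ones are exchanged. It is the full transpose of the partial
transpose in the other factor, so the two are positive semidefinite together. -/
def blockTranspose {n : Type*} (M : Matrix (n ⊕ n) (n ⊕ n) ℂ) : Matrix (n ⊕ n) (n ⊕ n) ℂ :=
  fromBlocks M.toBlocks₁₁ M.toBlocks₂₁ M.toBlocks₁₂ M.toBlocks₂₂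

section BlockTranspose

variable {m n : Type*}

@[simp]
theorem blockTranspose_fromBlocks (A B C D : Matrix n n ℂ) :
    blockTranspose (fromBlocks A B C D) = fromBlocks A C B D := by
  simp [blockTranspose]

theorem blockTranspose_add (M M' : Matrix (n ⊕ n) (n ⊕ n) ℂ) :
    blockTranspose (M + M') = blockTranspose M + blockTranspose M' := by
  rw [← fromBlocks_toBlocks M, ← fromBlocks_toBlocks M']
  simp [fromBlocks_add]

theorem blockTranspose_smul (c : ℂ) (M : Matrix (n ⊕ n) (n ⊕ n) ℂ) :
    blockTranspose (c • M) = c • blockTranspose M := by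
  rw [← fromBlocks_toBlocks M]
  simp [fromBlocks_smul]

theorem blockTranspose_sub (M M' : Matrix (n ⊕ n) (n ⊕ n) ℂ) :
    blockTranspose (M - M') = blockTranspose M - blockTranspose M' := by
  rw [sub_eq_add_neg, sub_eq_add_neg, blockTranspose_add, ← neg_one_smul ℂ M',
    blockTranspose_smul, neg_one_smul]

theorem blockTranspose_conjTranspose (M : Matrix (n ⊕ n) (n ⊕ n) ℂ) :
    blockTranspose Mᴴ = (blockTranspose M)ᴴ := by
  rw [← fromBlocks_toBlocks M]
  simp [fromBlocks_conjTranspose]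

/-- The matrix of `1 ⊗ K`, with the first tensor factor of dimension two. -/
def ampliation (K : Matrix m n ℂ) : Matrix (m ⊕ m) (n ⊕ n) ℂ :=
  fromBlocks K 0 0 K

theorem ampliation_mul [Fintype n] {l : Type*} (K : Matrix m n ℂ) (L : Matrix n l ℂ) :
    ampliation (K * L) = ampliation K * ampliation L := by
  simp [ampliation, fromBlocks_multiply]

theorem ampliation_one [DecidableEq n] : ampliation (1 : Matrix n n ℂ) = 1 := fromBlocks_one

theorem ampliation_conj_fromBlocks [Fintype n] (K : Matrix m n ℂ) (A B C D : Matrix n n ℂ) :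
    ampliation K * fromBlocks A B C D * (ampliation K)ᴴ =
      fromBlocks (K * A * Kᴴ) (K * B * Kᴴ) (K * C * Kᴴ) (K * D * Kᴴ) := by
  simp [ampliation, fromBlocks_multiply, fromBlocks_conjTranspose]

theorem blockTranspose_ampliation_conj [Fintype n] (K : Matrix m n ℂ)
    (M : Matrix (n ⊕ n) (n ⊕ n) ℂ) :
    blockTranspose (ampliation K * M * (ampliation K)ᴴ) =
      ampliation K * blockTranspose M * (ampliation K)ᴴ := by
  rw [← fromBlocks_toBlocks M]
  simp [ampliation_conj_fromBlocks]

end BlockTranspose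

/-- A `2 × 2` block matrix is PPT if it and its partial transpose are positive semidefinite. -/
structure IsPPT {n : Type*} (M : Matrix (n ⊕ n) (n ⊕ n) ℂ) : Prop where
  posSemidef : M.PosSemidef
  posSemidef_blockTranspose : (blockTranspose M).PosSemidef

theorem IsPPT.ampliation_conj {m n : Type*} [Fintype n] [Fintype m] (K : Matrix m n ℂ)
    {M : Matrix (n ⊕ n) (n ⊕ n) ℂ} (h : IsPPT M) :
    IsPPT (ampliation K * M * (ampliation K)ᴴ) :=
  ⟨h.1.mul_mul_conjTranspose_same _, by
    rw [blockTranspose_ampliation_conj]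
    exact h.2.mul_mul_conjTranspose_same _⟩

/-! ### The separable cone -/

/-- The product vector `(α, β) ⊗ v` of `ℂ² ⊗ ℂⁿ`. -/
def productVec {n : Type*} (α β : ℂ) (v : n → ℂ) : n ⊕ n → ℂ := Sum.elim (α • v) (β • v)

/-- The (unnormalised) projection onto the product vector `(α, β) ⊗ v`. -/
def productProj {n : Type*} (α β : ℂ) (v : n → ℂ) : Matrix (n ⊕ n) (n ⊕ n) ℂ :=
  vecMulVec (productVec α β v) (star (productVec α β v))

/-- The cone of unnormalised separable matrices. Since `productProj` absorbs nonnegative scalars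
into its vector, sums alone generate the cone. -/
def sepCone (n : Type*) : AddSubmonoid (Matrix (n ⊕ n) (n ⊕ n) ℂ) :=
  AddSubmonoid.closure {M | ∃ (α β : ℂ) (v : n → ℂ), M = productProj α β v}

section SepCone

variable {m n : Type*}

theorem productProj_mem_sepCone (α β : ℂ) (v : n → ℂ) : productProj α β v ∈ sepCone n :=
  AddSubmonoid.subset_closure ⟨α, β, v, rfl⟩

theorem productProj_eq_fromBlocks (α β : ℂ) (v : n → ℂ) :
    productProj α β v = fromBlocks ((α * star α) • vecMulVec v (star v))
      ((α * star β) • vecMulVec v (star v)) ((β * star α) • vecMulVec v (star v))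
      ((β * star β) • vecMulVec v (star v)) := by
  ext (i | i) (j | j) <;> simp [productProj, productVec, vecMulVec_apply] <;> ring

theorem ampliation_conj_productProj [Fintype n] (K : Matrix m n ℂ) (α β : ℂ) (v : n → ℂ) :
    ampliation K * productProj α β v * (ampliation K)ᴴ = productProj α β (K *ᵥ v) := by
  simp only [productProj_eq_fromBlocks, ampliation_conj_fromBlocks, Matrix.mul_smul,
    Matrix.smul_mul, mul_vecMulVec, vecMulVec_mul, star_mulVec]

theorem ampliation_conj_mem_sepCone [Fintype n] (K : Matrix m n ℂ)
    {M : Matrix (n ⊕ n) (n ⊕ n) ℂ} (hM : M ∈ sepCone n) :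
    ampliation K * M * (ampliation K)ᴴ ∈ sepCone m := by
  induction hM using AddSubmonoid.closure_induction with
  | mem M h =>
    obtain ⟨α, β, v, rfl⟩ := h
    rw [ampliation_conj_productProj]
    exact productProj_mem_sepCone _ _ _
  | zero => simp
  | add M M' _ _ h h' => rw [Matrix.mul_add, Matrix.add_mul]; exact add_mem h h'

theorem fromBlocks_zero_mem_sepCone [Finite n] {X : Matrix n n ℂ} (hX : X.PosSemidef) :
    fromBlocks 0 0 0 X ∈ sepCone n := by
  obtain ⟨k, v, rfl⟩ := posSemidef_iff_eq_sum_vecMulVec.mp hX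
  have : fromBlocks 0 0 0 (∑ i, vecMulVec (v i) (star (v i))) = ∑ i, productProj 0 1 (v i) := by
    simp only [productProj_eq_fromBlocks]
    ext (i | i) (j | j) <;> simp [Matrix.sum_apply]
  rw [this]
  exact sum_mem fun i _ => productProj_mem_sepCone _ _ _

end SepCone

/-! ### Normal matrices -/

theorem sum_vecMulVec_orthonormalBasis {ι n : Type*} [Fintype ι] [Fintype n] [DecidableEq n]
    (v : OrthonormalBasis ι ℂ (EuclideanSpace ℂ n)) :
    ∑ i, vecMulVec (v i).ofLp (star (v i).ofLp) = (1 : Matrix n n ℂ) := by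
  ext j k
  have h := v.sum_inner_mul_inner (EuclideanSpace.single j (1 : ℂ)) (EuclideanSpace.single k 1)
  simp only [EuclideanSpace.inner_single_left, EuclideanSpace.inner_single_right] at h
  simp only [Matrix.sum_apply, vecMulVec_apply, Pi.star_apply, Matrix.one_apply]
  simpa [eq_comm] using h

/-- Commuting symmetric operators have a common orthonormal eigenbasis. -/
theorem exists_orthonormalBasis_of_commute {E : Type*} [NormedAddCommGroup E]
    [InnerProductSpace ℂ E] [FiniteDimensional ℂ E] {S T : E →ₗ[ℂ] E} (hS : S.IsSymmetric)
    (hT : T.IsSymmetric) (hST : Commute S T) :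
    ∃ v : OrthonormalBasis (Fin (Module.finrank ℂ E)) ℂ E,
      ∃ s t : Fin (Module.finrank ℂ E) → ℂ, ∀ i, S (v i) = s i • v i ∧ T (v i) = t i • v i := by
  classical
  have hV := LinearMap.IsSymmetric.directSum_isInternal_of_commute hS hT hST
  have hO := LinearMap.IsSymmetric.orthogonalFamily_eigenspace_inf_eigenspace hS hT
  -- Only finitely many joint eigenspaces are nonzero; discard the others.
  have hfin := WellFoundedGT.finite_ne_bot_of_iSupIndep hV.submodule_iSupIndep
  have := hfin.fintype
  have hV' := DirectSum.isInternal_ne_bot_iff.mpr hV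
  have hO' := hO.comp (Subtype.val_injective (p := fun i : ℂ × ℂ =>
    (Module.End.eigenspace S i.2 ⊓ Module.End.eigenspace T i.1 : Submodule ℂ E) ≠ ⊥))
  have : Fintype {i : ℂ × ℂ //
    (Module.End.eigenspace S i.2 ⊓ Module.End.eigenspace T i.1 : Submodule ℂ E) ≠ ⊥} := this
  refine ⟨hV'.subordinateOrthonormalBasis rfl hO',
    fun i => (hV'.subordinateOrthonormalBasisIndex rfl i hO').1.2,
    fun i => (hV'.subordinateOrthonormalBasisIndex rfl i hO').1.1, fun i => ?_⟩
  have := hV'.subordinateOrthonormalBasis_subordinate rfl i hO'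
  rw [Submodule.mem_inf, Module.End.mem_eigenspace_iff, Module.End.mem_eigenspace_iff] at this
  exact this

theorem exists_sum_vecMulVec_of_normal {n : Type*} [Fintype n] [DecidableEq n]
    {B : Matrix n n ℂ} (hB : Bᴴ * B = B * Bᴴ) :
    ∃ (k : ℕ) (v : Fin k → n → ℂ) (b : Fin k → ℂ),
      ∑ i, vecMulVec (v i) (star (v i)) = 1 ∧ (∀ i, B *ᵥ v i = b i • v i) := by
  -- The Hermitian and skew-Hermitian parts of a normal matrix commute.
  set H : Matrix n n ℂ := B + Bᴴ with hH
  set K : Matrix n n ℂ := Complex.I • (B - Bᴴ) with hK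
  have hHh : H.IsHermitian := by
    simp [hH, IsHermitian, add_comm]
  have hKh : K.IsHermitian := by
    simp [hK, IsHermitian, conjTranspose_smul, ← smul_neg]
  have hc : Commute H K := by
    simp only [hH, hK, Commute, SemiconjBy, Matrix.mul_smul, Matrix.smul_mul]
    congr 1
    simp only [Matrix.mul_sub, Matrix.add_mul, Matrix.sub_mul, Matrix.mul_add, hB]
    abel
  obtain ⟨v, s, t, hv⟩ := exists_orthonormalBasis_of_commute (S := toEuclideanLin H)
    (T := toEuclideanLin K) (isSymmetric_toEuclideanLin_iff.mpr hHh)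
    (isSymmetric_toEuclideanLin_iff.mpr hKh) (by
      have := congrArg (toLpLin 2 2) hc.eq
      rwa [toLpLin_mul_same, toLpLin_mul_same] at this)
  refine ⟨_, fun i => (v i).ofLp, fun i => (1 / 2) * (s i - Complex.I * t i),
    sum_vecMulVec_orthonormalBasis v, fun i => ?_⟩
  have h1 : H *ᵥ (v i).ofLp = s i • (v i).ofLp := by
    simpa using congrArg WithLp.ofLp (hv i).1
  have h2 : K *ᵥ (v i).ofLp = t i • (v i).ofLp := by
    simpa using congrArg WithLp.ofLp (hv i).2
  have h3 : B = (1 / 2 : ℂ) • (H - Complex.I • K) := by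
    rw [hH, hK, smul_smul, Complex.I_mul_I]
    ext i j
    simp
    ring
  conv_lhs => rw [h3]
  rw [smul_mulVec, sub_mulVec, smul_mulVec, h1, h2]
  ext j
  simp
  ring

/-- If `B` is normal, an eigenbasis `v i` with eigenvalues `b i` decomposes the block matrix as the
sum of the projections onto the product vectors `(1, conj (b i)) ⊗ v i`. -/
theorem fromBlocks_mem_sepCone_of_normal {n : Type*} [Fintype n] [DecidableEq n]
    {B : Matrix n n ℂ} (hB : Bᴴ * B = B * Bᴴ) :
    fromBlocks 1 B Bᴴ (Bᴴ * B) ∈ sepCone n := by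
  obtain ⟨k, v, b, h1, hv⟩ := exists_sum_vecMulVec_of_normal hB
  have hb : B = ∑ i, b i • vecMulVec (v i) (star (v i)) := by
    conv_lhs => rw [← Matrix.mul_one B, ← h1, Finset.mul_sum]
    simp [mul_vecMulVec, hv, smul_vecMulVec]
  have hbs : Bᴴ = ∑ i, star (b i) • vecMulVec (v i) (star (v i)) := by
    conv_lhs => rw [hb]
    simp [conjTranspose_sum, conjTranspose_smul, conjTranspose_vecMulVec]
  have hbb : Bᴴ * B = ∑ i, (star (b i) * b i) • vecMulVec (v i) (star (v i)) := by
    rw [hB]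
    conv_lhs => rw [hbs]
    simp only [Finset.mul_sum, Matrix.mul_smul, mul_vecMulVec, hv, smul_vecMulVec, smul_smul]
  have : fromBlocks 1 B Bᴴ (Bᴴ * B) = ∑ i, productProj 1 (star (b i)) (v i) := by
    rw [hbb, hbs, ← h1]
    nth_rewrite 1 [hb]
    simp only [productProj_eq_fromBlocks]
    ext (i | i) (j | j) <;> simp [Matrix.sum_apply]
  rw [this]
  exact sum_mem fun i _ => productProj_mem_sepCone _ _ _

/-! ### Ranks and extreme eigenvalues -/

section Rank

variable {n : Type*} [Fintype n]

theorem _root_.Matrix.IsHermitian.eq_sum_eigenvalues_smul [DecidableEq n] {D : Matrix n n ℂ}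
    (hD : D.IsHermitian) :
    D = ∑ i, (hD.eigenvalues i : ℂ) • vecMulVec (hD.eigenvectorBasis i).ofLp
      (star (hD.eigenvectorBasis i).ofLp) := by
  conv_lhs => rw [← Matrix.mul_one D, ← sum_vecMulVec_orthonormalBasis hD.eigenvectorBasis,
    Finset.mul_sum]
  simp only [mul_vecMulVec, hD.mulVec_eigenvectorBasis, smul_vecMulVec, Complex.coe_smul]

/-- A positive semidefinite matrix factors through a space whose dimension is its rank. -/
theorem _root_.Matrix.PosSemidef.exists_eq_mul_conjTranspose {P : Matrix n n ℂ}
    (hP : P.PosSemidef) : ∃ V : Matrix n (Fin P.rank) ℂ, P = V * Vᴴ := by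
  classical
  have hc := hP.1.rank_eq_card_non_zero_eigs
  let e := Fintype.equivFinOfCardEq hc.symm
  let W : Matrix n {i // hP.1.eigenvalues i ≠ 0} ℂ :=
    .of fun j i => (√(hP.1.eigenvalues i) : ℂ) * (hP.1.eigenvectorBasis i).ofLp j
  refine ⟨W.submatrix id e.symm, ?_⟩
  rw [conjTranspose_submatrix, submatrix_mul_equiv, submatrix_id_id]
  ext j k
  conv_lhs => rw [hP.1.eq_sum_eigenvalues_smul]
  simp only [W, Matrix.sum_apply, Matrix.smul_apply, vecMulVec_apply, mul_apply,
    conjTranspose_apply, of_apply, smul_eq_mul, Pi.star_apply, star_mul']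
  rw [← Fintype.sum_subtype_add_sum_subtype fun i => hP.1.eigenvalues i ≠ 0,
    Finset.sum_eq_zero (s := (Finset.univ : Finset {i // ¬ hP.1.eigenvalues i ≠ 0}))
      fun i _ => by simp [not_not.mp i.2], add_zero]
  refine Finset.sum_congr rfl fun i _ => ?_
  have hsq : ∀ x : ℝ, 0 ≤ x → ((√x : ℝ) : ℂ) * star ((√x : ℝ) : ℂ) = x := fun x hx => by
    rw [RCLike.star_def, Complex.conj_ofReal, ← Complex.ofReal_mul, Real.mul_self_sqrt hx]
  rw [← hsq _ (hP.eigenvalues_nonneg i)]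
  ring

theorem _root_.Matrix.rank_lt_card_of_mulVec_eq_zero {P : Matrix n n ℂ} {v : n → ℂ} (hv : v ≠ 0)
    (h : P *ᵥ v = 0) : P.rank < Fintype.card n := by
  classical
  refine lt_of_le_of_ne (rank_le_card_width P) fun hr => hv ?_
  have h1 := LinearMap.finrank_range_add_finrank_ker P.mulVecLin
  rw [← Matrix.rank, hr, Module.finrank_pi, Nat.add_eq_left, Submodule.finrank_eq_zero] at h1
  have : v ∈ LinearMap.ker P.mulVecLin := by simpa using h
  simpa [h1] using this

/-- Subtracting the extreme eigenvalues of a non-scalar Hermitian matrix leaves, up to sign, two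
singular positive semidefinite matrices. -/
theorem _root_.Matrix.IsHermitian.exists_extreme_eigenvalues [Nonempty n] [DecidableEq n]
    {D : Matrix n n ℂ} (hD : D.IsHermitian) (hs : ∀ c : ℂ, D ≠ c • 1) :
    ∃ lo hi : ℝ, lo < hi ∧ (D - (lo : ℂ) • 1).PosSemidef ∧ ((hi : ℂ) • 1 - D).PosSemidef ∧
      (∃ v ≠ 0, D *ᵥ v = (lo : ℂ) • v) ∧ ∃ v ≠ 0, D *ᵥ v = (hi : ℂ) • v := by
  obtain ⟨i, hi⟩ := Finite.exists_min hD.eigenvalues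
  obtain ⟨j, hj⟩ := Finite.exists_max hD.eigenvalues
  have hone := sum_vecMulVec_orthonormalBasis hD.eigenvectorBasis
  have hev : ∀ i, ∃ v ≠ 0, D *ᵥ v = (hD.eigenvalues i : ℂ) • v := fun i =>
    ⟨(hD.eigenvectorBasis i).ofLp, by simpa using hD.eigenvectorBasis.orthonormal.ne_zero i,
      by rw [hD.mulVec_eigenvectorBasis, Complex.coe_smul]⟩
  have key : ∀ c : ℂ, D - c • 1 = ∑ i, ((hD.eigenvalues i : ℂ) - c) •
      vecMulVec (hD.eigenvectorBasis i).ofLp (star (hD.eigenvectorBasis i).ofLp) := fun c => by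
    conv_lhs => rw [hD.eq_sum_eigenvalues_smul, ← hone, Finset.smul_sum]
    simp only [sub_smul, Finset.sum_sub_distrib]
  refine ⟨hD.eigenvalues i, hD.eigenvalues j, lt_of_le_of_ne (hi j) fun hij => ?_, ?_, ?_,
    hev i, hev j⟩
  · refine hs (hD.eigenvalues i) (sub_eq_zero.mp ?_)
    rw [key]
    refine Finset.sum_eq_zero fun k _ => ?_
    rw [le_antisymm (hij ▸ hj k) (hi k), sub_self, zero_smul]
  · rw [key]
    refine posSemidef_sum _ fun k _ => (posSemidef_vecMulVec_self_star _).smul ?_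
    rw [← Complex.ofReal_sub]
    exact_mod_cast sub_nonneg.mpr (hi k)
  · rw [← neg_sub, key, ← Finset.sum_neg_distrib]
    refine posSemidef_sum _ fun k _ => ?_
    rw [← neg_smul, neg_sub]
    refine (posSemidef_vecMulVec_self_star _).smul ?_
    rw [← Complex.ofReal_sub]
    exact_mod_cast sub_nonneg.mpr (hj k)

end Rank

/-! ### Splitting PPT matrices of large rank -/

section Splitting

variable {n : Type*} [Fintype n]

/-- For factorisations `V * Vᴴ` of a block matrix and `W * Wᴴ` of its partial transpose, the pairs
`(P, Q)` for which `V * P * Vᴴ` has partial transpose `W * Q * Wᴴ` form a complex subspace that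
contains `(1, 1)` and is closed under the adjoint. If the widths of `V` and `W` are large, counting
dimensions gives a Hermitian pair outside the line through `(1, 1)`. -/
theorem exists_isHermitian_dependency {r s : Type*} [Fintype r] [Fintype s] [DecidableEq r]
    [DecidableEq s] (V : Matrix (n ⊕ n) r ℂ) (W : Matrix (n ⊕ n) s ℂ)
    (hVW : blockTranspose (V * Vᴴ) = W * Wᴴ)
    (hcard : 4 * Fintype.card n ^ 2 + 1 < Fintype.card r ^ 2 + Fintype.card s ^ 2) :
    ∃ (P : Matrix r r ℂ) (Q : Matrix s s ℂ), P.IsHermitian ∧ Q.IsHermitian ∧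
      blockTranspose (V * P * Vᴴ) = W * Q * Wᴴ ∧ ∀ c : ℂ, (P, Q) ≠ c • (1, 1) := by
  let Φ : Matrix r r ℂ × Matrix s s ℂ →ₗ[ℂ] Matrix (n ⊕ n) (n ⊕ n) ℂ :=
    { toFun := fun x => blockTranspose (V * x.1 * Vᴴ) - W * x.2 * Wᴴ
      map_add' := fun x y => by
        simp only [Prod.fst_add, Prod.snd_add, Matrix.mul_add, Matrix.add_mul, blockTranspose_add]
        abel
      map_smul' := fun c x => by
        simp only [Prod.smul_fst, Prod.smul_snd, Matrix.mul_smul, Matrix.smul_mul,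
          blockTranspose_smul, smul_sub, RingHom.id_apply] }
  have hker : ∀ x, x ∈ LinearMap.ker Φ ↔ blockTranspose (V * x.1 * Vᴴ) = W * x.2 * Wᴴ :=
    fun x => by rw [LinearMap.mem_ker]; exact sub_eq_zero
  have hone : (1, 1) ∈ LinearMap.ker Φ := by rw [hker]; simpa using hVW
  have hstar : ∀ x ∈ LinearMap.ker Φ, star x ∈ LinearMap.ker Φ := fun x hx => by
    rw [hker] at hx ⊢
    have := congrArg conjTranspose hx
    rw [← blockTranspose_conjTranspose] at this
    simpa [Matrix.mul_assoc, star_eq_conjTranspose] using this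
  have hnot : ¬ LinearMap.ker Φ ≤ Submodule.span ℂ {(1, 1)} := fun hle => by
    have h1 := Submodule.finrank_mono hle
    have h2 := finrank_span_le_card (R := ℂ) {((1, 1) : Matrix r r ℂ × Matrix s s ℂ)}
    rw [Set.toFinset_singleton, Finset.card_singleton] at h2
    have h3 := LinearMap.finrank_range_add_finrank_ker Φ
    have h4 := Submodule.finrank_le (LinearMap.range Φ)
    rw [Module.finrank_prod, Module.finrank_matrix, Module.finrank_matrix] at h3
    rw [Module.finrank_matrix] at h4
    simp only [Module.finrank_self, mul_one, Fintype.card_sum] at h3 h4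
    nlinarith
  obtain ⟨x, hx, hxs⟩ := SetLike.not_le_iff_exists.mp hnot
  have hherm : ∀ y ∈ LinearMap.ker Φ, star y = y → y ∉ Submodule.span ℂ {(1, 1)} →
      ∃ (P : Matrix r r ℂ) (Q : Matrix s s ℂ), P.IsHermitian ∧ Q.IsHermitian ∧
      blockTranspose (V * P * Vᴴ) = W * Q * Wᴴ ∧ ∀ c : ℂ, (P, Q) ≠ c • (1, 1) :=
    fun y hy hys hyn => ⟨y.1, y.2, congrArg Prod.fst hys, congrArg Prod.snd hys, (hker y).mp hy,
      fun c hc => hyn (Submodule.mem_span_singleton.mpr ⟨c, hc.symm⟩)⟩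
  -- One of the real and imaginary parts of `x` lies outside the line.
  by_cases h : x + star x ∈ Submodule.span ℂ {((1, 1) : Matrix r r ℂ × Matrix s s ℂ)}
  · refine hherm (Complex.I • (x - star x)) (Submodule.smul_mem _ _ (sub_mem hx (hstar x hx)))
      (by simp [star_smul, ← smul_neg]) fun h' => hxs ?_
    have h2 : x = (1 / 2 : ℂ) • ((x + star x) - Complex.I • (Complex.I • (x - star x))) := by
      rw [smul_smul, Complex.I_mul_I]
      module
    rw [h2]
    exact Submodule.smul_mem _ _ (sub_mem h (Submodule.smul_mem _ _ h'))
  · exact hherm _ (add_mem hx (hstar x hx)) (by simp [add_comm]) h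

theorem rank_add_rank_lt {r s : Type*} [Fintype r] [Fintype s] {P : Matrix r r ℂ}
    {Q : Matrix s s ℂ} {v : r ⊕ s → ℂ} (hv : v ≠ 0) (h : fromBlocks P 0 0 Q *ᵥ v = 0) :
    P.rank + Q.rank < Fintype.card r + Fintype.card s := by
  rw [fromBlocks_mulVec] at h
  have h1 : P *ᵥ (v ∘ Sum.inl) = 0 := by
    ext i; simpa using congrFun h (Sum.inl i)
  have h2 : Q *ᵥ (v ∘ Sum.inr) = 0 := by
    ext i; simpa using congrFun h (Sum.inr i)
  by_cases hz : v ∘ Sum.inl = 0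
  · have hz' : v ∘ Sum.inr ≠ 0 := fun hz' => hv (by
      ext (i | i)
      · exact congrFun hz i
      · exact congrFun hz' i)
    have := rank_le_card_width P
    have := rank_lt_card_of_mulVec_eq_zero hz' h2
    omega
  · have := rank_le_card_width Q
    have := rank_lt_card_of_mulVec_eq_zero hz h1
    omega

/-- A PPT matrix whose ranks `r` and `s` satisfy `r² + s² > 4 n² + 1` does not span an extreme ray
of the PPT cone. With `(P, Q)` as in `exists_isHermitian_dependency`, and `lo`, `hi` the extreme
eigenvalues of the block diagonal matrix of `P` and `Q`, the pairs `(P - lo, Q - lo)` and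
`(hi - P, hi - Q)` add up to a multiple of `(1, 1)`, and both are positive semidefinite and
singular, so that the summands they define have smaller total rank. -/
theorem IsPPT.exists_add_eq_of_lt {M : Matrix (n ⊕ n) (n ⊕ n) ℂ} (hM : IsPPT M)
    (hcard : 4 * Fintype.card n ^ 2 + 1 < M.rank ^ 2 + (blockTranspose M).rank ^ 2) :
    ∃ M₁ M₂ : Matrix (n ⊕ n) (n ⊕ n) ℂ, M = M₁ + M₂ ∧ IsPPT M₁ ∧ IsPPT M₂ ∧
      M₁.rank + (blockTranspose M₁).rank < M.rank + (blockTranspose M).rank ∧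
      M₂.rank + (blockTranspose M₂).rank < M.rank + (blockTranspose M).rank := by
  obtain ⟨V, hV⟩ := hM.1.exists_eq_mul_conjTranspose
  obtain ⟨W, hW⟩ := hM.2.exists_eq_mul_conjTranspose
  obtain ⟨P, Q, hP, hQ, hPQ, hne⟩ := exists_isHermitian_dependency V W
    (by rw [← hV, ← hW]) (by simpa using hcard)
  have hVW : blockTranspose (V * Vᴴ) = W * Wᴴ := by rw [← hV, ← hW]
  have hDh : (fromBlocks P 0 0 Q).IsHermitian := IsHermitian.fromBlocks hP (by simp) hQ
  have : Nonempty (Fin M.rank ⊕ Fin (blockTranspose M).rank) := by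
    by_contra h
    rw [not_nonempty_iff, ← Fintype.card_eq_zero_iff, Fintype.card_sum, Fintype.card_fin,
      Fintype.card_fin, Nat.add_eq_zero_iff] at h
    rw [h.1, h.2] at hcard
    simp at hcard
  obtain ⟨lo, hi, hlt, hlo, hhi, ⟨v, hv, hDv⟩, w, hw, hDw⟩ :=
    hDh.exists_extreme_eigenvalues fun c hc => hne c (by
      rw [← fromBlocks_one, fromBlocks_smul, fromBlocks_inj] at hc
      exact Prod.ext hc.1 hc.2.2.2)
  set κ : ℂ := (((hi - lo)⁻¹ : ℝ) : ℂ) with hκ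
  have hpos : 0 ≤ κ := by
    rw [hκ]; exact_mod_cast (inv_pos.mpr (sub_pos.mpr hlt)).le
  have hκ1 : κ * (hi - lo) = 1 := by
    rw [hκ, ← Complex.ofReal_sub, ← Complex.ofReal_mul, inv_mul_cancel₀ (sub_pos.mpr hlt).ne',
      Complex.ofReal_one]
  -- The summand defined by a singular positive semidefinite pair `(P', Q')`, scaled by `κ`.
  have piece : ∀ (P' : Matrix (Fin M.rank) (Fin M.rank) ℂ)
      (Q' : Matrix (Fin (blockTranspose M).rank) (Fin (blockTranspose M).rank) ℂ),
      blockTranspose (V * P' * Vᴴ) = W * Q' * Wᴴ → (fromBlocks P' 0 0 Q').PosSemidef →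
      (∃ v ≠ 0, fromBlocks P' 0 0 Q' *ᵥ v = 0) →
      IsPPT (V * (κ • P') * Vᴴ) ∧
      (V * (κ • P') * Vᴴ).rank + (blockTranspose (V * (κ • P') * Vᴴ)).rank <
        M.rank + (blockTranspose M).rank := by
    rintro P' Q' hPQ' hps ⟨v, hv, hv0⟩
    have h1 : blockTranspose (V * (κ • P') * Vᴴ) = W * (κ • Q') * Wᴴ := by
      simp only [Matrix.mul_smul, Matrix.smul_mul, blockTranspose_smul, hPQ']
    have hP' : P'.PosSemidef := hps.submatrix Sum.inl
    have hQ' : Q'.PosSemidef := hps.submatrix Sum.inr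
    refine ⟨⟨(hP'.smul hpos).mul_mul_conjTranspose_same _, ?_⟩, ?_⟩
    · rw [h1]
      exact (hQ'.smul hpos).mul_mul_conjTranspose_same _
    · have hlt := rank_add_rank_lt hv hv0
      rw [Fintype.card_fin, Fintype.card_fin] at hlt
      have hr : ∀ {k : ℕ} (U : Matrix (n ⊕ n) (Fin k) ℂ) (R : Matrix (Fin k) (Fin k) ℂ),
          (U * (κ • R) * Uᴴ).rank ≤ R.rank := fun U R => by
        rw [Matrix.mul_smul, ← Matrix.smul_mul, Matrix.mul_assoc]
        exact (rank_mul_le_right _ _).trans (rank_mul_le_left _ _)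
      rw [h1]
      have h2 := hr V P'
      have h3 := hr W Q'
      omega
  have hblock : ∀ c : ℂ, fromBlocks (P - c • 1) 0 0 (Q - c • 1) =
      fromBlocks P 0 0 Q - c • 1 := fun c => by
    simp [← fromBlocks_one, fromBlocks_smul, sub_eq_add_neg, fromBlocks_neg, fromBlocks_add]
  have hblock' : ∀ c : ℂ, fromBlocks (c • 1 - P) 0 0 (c • 1 - Q) =
      c • 1 - fromBlocks P 0 0 Q := fun c => by
    rw [← neg_sub (fromBlocks P 0 0 Q), ← hblock, fromBlocks_neg]
    simp
  obtain ⟨h1, h1'⟩ := piece (P - (lo : ℂ) • 1) (Q - (lo : ℂ) • 1)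
    (by simp only [Matrix.mul_sub, Matrix.sub_mul, blockTranspose_sub, hPQ, Matrix.mul_smul,
          Matrix.smul_mul, blockTranspose_smul, Matrix.mul_one, hVW])
    (by rwa [hblock]) ⟨v, hv, by rw [hblock, sub_mulVec, smul_mulVec, one_mulVec, hDv, sub_self]⟩
  obtain ⟨h2, h2'⟩ := piece ((hi : ℂ) • 1 - P) ((hi : ℂ) • 1 - Q)
    (by simp only [Matrix.mul_sub, Matrix.sub_mul, blockTranspose_sub, hPQ, Matrix.mul_smul,
          Matrix.smul_mul, blockTranspose_smul, Matrix.mul_one, hVW])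
    (by rwa [hblock']) ⟨w, hw, by rw [hblock', sub_mulVec, smul_mulVec, one_mulVec, hDw, sub_self]⟩
  refine ⟨_, _, ?_, h1, h2, h1', h2'⟩
  rw [← Matrix.add_mul, ← Matrix.mul_add, ← smul_add, sub_add_sub_comm, add_comm P,
    add_sub_add_right_eq_sub, ← sub_smul, smul_smul, hκ1, one_smul, Matrix.mul_one, ← hV]

end Splitting

/-! ### Reducing the dimension -/

section Reduction

variable {n : Type*} [Fintype n] [DecidableEq n]

omit [DecidableEq n] in
theorem _root_.Matrix.PosSemidef.sub_smul_vecMulVec_mulVec_eq_zero {M : Matrix n n ℂ}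
    (hM : M.PosSemidef) (u : n → ℂ) :
    (M - (star u ⬝ᵥ M *ᵥ u)⁻¹ • vecMulVec (M *ᵥ u) (star (M *ᵥ u))) *ᵥ u = 0 := by
  have hs : star (M *ᵥ u) ⬝ᵥ u = star u ⬝ᵥ M *ᵥ u := by
    rw [star_mulVec, hM.1.eq, ← dotProduct_mulVec]
  rw [sub_mulVec, smul_mulVec, vecMulVec_mulVec, hs]
  rcases eq_or_ne (star u ⬝ᵥ M *ᵥ u) 0 with h0 | h0
  · rw [(hM.dotProduct_mulVec_zero_iff u).mp h0]
    simp
  · ext i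
    simp [h0]

/-- Subtracting from a positive semidefinite matrix the largest possible multiple of the projection
onto `M *ᵥ u` preserves positivity. If `u` is in the kernel, nothing is subtracted, as `0⁻¹ = 0`. -/
theorem _root_.Matrix.PosSemidef.sub_smul_vecMulVec {M : Matrix n n ℂ} (hM : M.PosSemidef)
    (u : n → ℂ) :
    (M - (star u ⬝ᵥ M *ᵥ u)⁻¹ • vecMulVec (M *ᵥ u) (star (M *ᵥ u))).PosSemidef := by
  have h0 := hM.sub_smul_vecMulVec_mulVec_eq_zero u
  set γ := star u ⬝ᵥ M *ᵥ u with hγ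
  have hγs : star γ = γ := by
    rw [(hM.dotProduct_mulVec_nonneg u).isSelfAdjoint.star_eq]
  have hu : star u ᵥ* M = star (M *ᵥ u) := by
    rw [star_mulVec, hM.1.eq]
  convert hM.conjTranspose_mul_mul_same (1 - γ⁻¹ • vecMulVec u (star (M *ᵥ u))) using 1
  rw [conjTranspose_sub, conjTranspose_one, conjTranspose_smul, conjTranspose_vecMulVec, star_star,
    star_inv₀, hγs]
  simp only [Matrix.sub_mul, Matrix.mul_sub, Matrix.one_mul, Matrix.mul_one, Matrix.smul_mul,
    Matrix.mul_smul, vecMulVec_mul, mul_vecMulVec, hu, h0]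
  simp

/-- If the upper left block of a PPT matrix kills `f`, so do the off-diagonal blocks. After removing
a product projection from the lower right block every block kills `f`, and what remains lives on the
orthogonal complement of `f`, a space of smaller dimension. -/
theorem IsPPT.mem_sepCone_of_mulVec_eq_zero {A B C D : Matrix n n ℂ}
    (hM : IsPPT (fromBlocks A B C D)) {f : n → ℂ} (hf : f ≠ 0) (hAf : A *ᵥ f = 0)
    (ih : ∀ k < Fintype.card n, ∀ M : Matrix (Fin k ⊕ Fin k) (Fin k ⊕ Fin k) ℂ,
      IsPPT M → M ∈ sepCone (Fin k)) :
    fromBlocks A B C D ∈ sepCone n := by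
  have hM2 := hM.2
  rw [blockTranspose_fromBlocks] at hM2
  have hker : ∀ {B' C' : Matrix n n ℂ}, (fromBlocks A B' C' D).PosSemidef → C' *ᵥ f = 0 :=
    fun {B' C'} h => by
      have h0 := (h.dotProduct_mulVec_zero_iff (Sum.elim f 0)).mp (by
        rw [fromBlocks_mulVec]
        simp [hAf, dotProduct, Fintype.sum_sum_type])
      rw [fromBlocks_mulVec] at h0
      ext i
      simpa using congrFun h0 (Sum.inr i)
  have hCf := hker hM.1
  have hBf := hker hM2
  obtain ⟨hA, hBC, -, hD⟩ := isHermitian_fromBlocks_iff.mp hM.1.1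
  have hDp : D.PosSemidef := hM.1.submatrix Sum.inr
  set γ := star f ⬝ᵥ D *ᵥ f with hγ
  set D₀ := D - γ⁻¹ • vecMulVec (D *ᵥ f) (star (D *ᵥ f)) with hD₀
  have hschur : ∀ {B' C' : Matrix n n ℂ}, (fromBlocks A B' C' D).PosSemidef → B' *ᵥ f = 0 →
      (fromBlocks A B' C' D₀).PosSemidef := fun {B' C'} h hB' => by
    have h1 := h.sub_smul_vecMulVec (Sum.elim 0 f)
    have hv : fromBlocks A B' C' D *ᵥ Sum.elim 0 f =
        (Sum.elim 0 (D *ᵥ f) : n ⊕ n → ℂ) := by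
      rw [fromBlocks_mulVec]
      ext (i | i) <;> simp [hB']
    have hs : star (Sum.elim 0 f : n ⊕ n → ℂ) ⬝ᵥ Sum.elim 0 (D *ᵥ f) = γ := by
      simp [dotProduct, Fintype.sum_sum_type, hγ]
    rw [hv, hs] at h1
    convert h1 using 1
    ext (i | i) (j | j) <;> simp [hD₀, vecMulVec_apply]
  have hM0 : IsPPT (fromBlocks A B C D₀) :=
    ⟨hschur hM.1 hBf, by rw [blockTranspose_fromBlocks]; exact hschur hM2 hCf⟩
  have hD0h : D₀ᴴ = D₀ := (isHermitian_fromBlocks_iff.mp hM0.1.1).2.2.2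
  have hD0f : D₀ *ᵥ f = 0 := hDp.sub_smul_vecMulVec_mulVec_eq_zero f
  -- The orthogonal projection onto the complement of `f`.
  set p : Matrix n n ℂ := 1 - (star f ⬝ᵥ f)⁻¹ • vecMulVec f (star f) with hp
  have hpp : p.PosSemidef := by
    simpa using (PosSemidef.one (n := n) (R := ℂ)).sub_smul_vecMulVec f
  have hpf : p *ᵥ f = 0 := by
    simpa using (PosSemidef.one (n := n) (R := ℂ)).sub_smul_vecMulVec_mulVec_eq_zero f
  have hright : ∀ {Z : Matrix n n ℂ}, Z *ᵥ f = 0 → Z * p = Z := fun {Z} hZ => by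
    rw [hp, Matrix.mul_sub, Matrix.mul_one, Matrix.mul_smul, mul_vecMulVec, hZ]
    simp
  have hconj : ∀ {Z : Matrix n n ℂ}, Z *ᵥ f = 0 → Zᴴ *ᵥ f = 0 → p * Z * pᴴ = Z :=
    fun {Z} hZ hZ' => by
      rw [hpp.1.eq, Matrix.mul_assoc, hright hZ]
      have := congrArg conjTranspose (hright hZ')
      rwa [conjTranspose_mul, conjTranspose_conjTranspose, hpp.1.eq] at this
  obtain ⟨V, hV⟩ := hpp.exists_eq_mul_conjTranspose
  have hmem := ampliation_conj_mem_sepCone V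
    (ih _ (rank_lt_card_of_mulVec_eq_zero hf hpf) _ (hM0.ampliation_conj Vᴴ))
  have heq : ampliation V * (ampliation Vᴴ * fromBlocks A B C D₀ * (ampliation Vᴴ)ᴴ) *
      (ampliation V)ᴴ = fromBlocks A B C D₀ := by
    calc _ = ampliation p * fromBlocks A B C D₀ * (ampliation p)ᴴ := by
          rw [congrArg ampliation hV, ampliation_mul, conjTranspose_mul]
          simp only [Matrix.mul_assoc]
      _ = _ := by
          rw [ampliation_conj_fromBlocks, hconj hAf (by rw [hA]; exact hAf),
            hconj hBf (by rw [hBC]; exact hCf),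
            hconj hCf (by rw [← hBC, conjTranspose_conjTranspose]; exact hBf),
            hconj hD0f (by rw [hD0h]; exact hD0f)]
  rw [heq] at hmem
  have hγ0 : 0 ≤ γ⁻¹ := inv_nonneg.mpr (hDp.dotProduct_mulVec_nonneg f)
  have hsum : fromBlocks A B C D = fromBlocks A B C D₀ +
      fromBlocks 0 0 0 (γ⁻¹ • vecMulVec (D *ᵥ f) (star (D *ᵥ f))) := by
    simp [fromBlocks_add, hD₀]
  rw [hsum]
  exact add_mem hmem (fromBlocks_zero_mem_sepCone
    ((posSemidef_vecMulVec_self_star _).smul hγ0))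

end Reduction

/-! ### Aligning two triples of vectors in dimension three -/

section Dilation

theorem star_det_mul_det_eq_det_gram {n : Type*} [Fintype n] [DecidableEq n] (w : n → n → ℂ) :
    star (det (of w)) * det (of w) = det (of fun i j => star (w i) ⬝ᵥ w j) := by
  rw [← det_conjTranspose, ← det_transpose (of w)ᴴ, ← det_transpose (of w), ← det_mul]
  congr 1

theorem exists_norm_one_eq_mul {a b : ℂ} (h : star a * a = star b * b) :
    ∃ θ : ℂ, star θ * θ = 1 ∧ b = θ * a := by
  rcases eq_or_ne a 0 with ha | ha
  · have hb : b = 0 := by simpa [ha] using h.symm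
    exact ⟨1, by simp, by simp [ha, hb]⟩
  · refine ⟨b / a, ?_, by field_simp⟩
    rw [star_div₀, div_mul_div_comm, ← h, div_self]
    simpa using ha

/-- If the Gram matrices of `(x, y, p)` and `(y, x, q)` are complex conjugates of each other, then
the components of `p` and `q` orthogonal to `x` and `y` have equal length. In dimension three they
therefore differ by a phase `θ`, and `c` can be chosen so that the components along `x` and `y`
match as well. -/
theorem exists_sub_smul_eq_smul_sub {x y p q : Fin 3 → ℂ} (hxy : star x ⬝ᵥ x = star y ⬝ᵥ y)
    (hyq : star y ⬝ᵥ q = star (star x ⬝ᵥ p)) (hxq : star x ⬝ᵥ q = star (star y ⬝ᵥ p))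
    (hpq : star p ⬝ᵥ p = star q ⬝ᵥ q)
    (hne : (star x ⬝ᵥ x) ^ 2 - (star x ⬝ᵥ y) * (star y ⬝ᵥ x) ≠ 0) :
    ∃ θ c : ℂ, star θ * θ = 1 ∧ q - star c • y = θ • (p - c • x) := by
  have hst : ∀ v w : Fin 3 → ℂ, star (star v ⬝ᵥ w) = star w ⬝ᵥ v := fun v w => by
    rw [star_dotProduct, star_star]
  -- The Gram determinants of the two triples agree.
  have hdet : star (det (of ![x, y, p])) * det (of ![x, y, p]) =
      star (det (of ![x, y, q])) * det (of ![x, y, q]) := by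
    rw [star_det_mul_det_eq_det_gram, star_det_mul_det_eq_det_gram]
    have hqy := hst y q
    have hqx := hst x q
    have hpx := hst x p
    have hpy := hst y p
    rw [hyq, star_star] at hqy
    rw [hxq, star_star] at hqx
    simp only [det_fin_three, of_apply, cons_val_zero, cons_val_one, cons_val_two,
      head_cons, tail_cons]
    rw [← hqy, ← hqx, hyq, hxq, hpq, hxy, hpx, hpy]
    ring
  obtain ⟨θ, hθ, hθdet⟩ := exists_norm_one_eq_mul hdet
  set a := star x ⬝ᵥ x with ha
  set s := star x ⬝ᵥ y with hs
  have hyx : star y ⬝ᵥ x = star s := (hst x y).symm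
  have haa : star a = a := hst x x
  set m := star x ⬝ᵥ p with hm
  set u := star y ⬝ᵥ p with hu
  rw [hyx] at hne
  -- `c` is the solution of the equation `hck`, to which both inner products with `F` below reduce.
  set k := m - star θ * star u with hk
  set c := (a * k + star θ * s * star k) / (a ^ 2 - s * star s) with hc
  have hceq : c * (a ^ 2 - s * star s) = a * k + star θ * s * star k := by
    rw [hc, div_mul_cancel₀ _ hne]
  have hceq' : star c * (a ^ 2 - s * star s) = a * star k + θ * star s * k := by
    have := congrArg star hceq
    simp only [star_mul', star_add, star_sub, star_pow, star_star, haa] at this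
    linear_combination this
  have hck : a * c - star θ * s * star c = k := by
    refine mul_right_cancel₀ hne ?_
    linear_combination a * hceq - star θ * s * hceq' - s * star s * k * hθ
  refine ⟨θ, c, hθ, sub_eq_zero.mp ?_⟩
  set F := q - star c • y - θ • (p - c • x) with hF
  have hxF : star x ⬝ᵥ F = 0 := by
    simp only [hF, dotProduct_sub, dotProduct_smul, smul_eq_mul, ← ha, ← hs, ← hm, hxq]
    linear_combination θ * hck + θ * hk + (s * star c - star u) * hθ
  have hyF : star y ⬝ᵥ F = 0 := by
    have := congrArg star hck
    simp only [hk, star_mul', star_sub, star_star, haa] at this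
    simp only [hF, dotProduct_sub, dotProduct_smul, smul_eq_mul, ← hxy, hyx, ← hu, hyq]
    linear_combination -this
  have hdF : det (of ![x, y, F]) = 0 := by
    have : det (of ![x, y, F]) = det (of ![x, y, q]) - θ * det (of ![x, y, p]) := by
      simp [det_fin_three, hF]
      ring
    rw [this, hθdet, sub_self]
  have hgram := star_det_mul_det_eq_det_gram ![x, y, F]
  rw [hdF, mul_zero] at hgram
  simp only [det_fin_three, of_apply, cons_val_zero, cons_val_one, cons_val_two,
      head_cons, tail_cons] at hgram
  rw [hxF, hyF, ← hxy, hyx, ← ha, ← hs] at hgram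
  -- The Gram determinant of `(x, y, F)` is that of `(x, y)` times the squared length of `F`.
  have hFF : star F ⬝ᵥ F = 0 := by
    refine (mul_eq_zero.mp (?_ : (a ^ 2 - s * star s) * _ = 0)).resolve_left hne
    linear_combination -hgram
  exact dotProduct_star_self_eq_zero.mp hFF

end Dilation

/-! ### The PPT cone equals the separable cone -/

section UnitBlock

variable {n : Type*} [Fintype n] [DecidableEq n]

omit [DecidableEq n] in
/-- The relations that make the Gram matrices of `(x, y, B x)` and `(y, x, Bᴴ y)` conjugate. They
are the traces of the hypothesis, of its product with `B`, and of its products with the four terms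
in it. -/
theorem gram_relations {B : Matrix n n ℂ} {x y : n → ℂ}
    (h : Bᴴ * B + vecMulVec x (star x) = B * Bᴴ + vecMulVec y (star y)) :
    star x ⬝ᵥ x = star y ⬝ᵥ y ∧ star x ⬝ᵥ B *ᵥ x = star y ⬝ᵥ B *ᵥ y ∧
      star (B *ᵥ x) ⬝ᵥ B *ᵥ x = star (Bᴴ *ᵥ y) ⬝ᵥ Bᴴ *ᵥ y := by
  have htr : ∀ (Z : Matrix n n ℂ) (v : n → ℂ),
      trace (Z * vecMulVec v (star v)) = star v ⬝ᵥ Z *ᵥ v := fun Z v => by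
    rw [mul_vecMulVec, trace_vecMulVec, dotProduct_comm]
  have hq : ∀ (Z : Matrix n n ℂ) (v : n → ℂ),
      star v ⬝ᵥ (Zᴴ * Z) *ᵥ v = star (Z *ᵥ v) ⬝ᵥ Z *ᵥ v := fun Z v => by
    rw [← mulVec_mulVec, dotProduct_mulVec, star_mulVec]
  have h0 : star x ⬝ᵥ x = star y ⬝ᵥ y := by
    have := congrArg trace h
    rw [trace_add, trace_add, trace_mul_comm Bᴴ, trace_vecMulVec, trace_vecMulVec] at this
    rw [dotProduct_comm, dotProduct_comm (star y)]
    exact add_left_cancel this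
  refine ⟨h0, ?_, ?_⟩
  · have := congrArg (fun Z => trace (B * Z)) h
    simp only [Matrix.mul_add, trace_add, htr] at this
    rw [← Matrix.mul_assoc, trace_mul_comm (B * Bᴴ)] at this
    exact add_left_cancel this
  · set P := Bᴴ * B with hP
    set Q := B * Bᴴ with hQ
    set X := vecMulVec x (star x) with hX
    set Y := vecMulVec y (star y) with hY
    have e1 := congrArg (fun Z => trace (P * Z)) h
    have e2 := congrArg (fun Z => trace (Q * Z)) h
    have e3 := congrArg (fun Z => trace (X * Z)) h
    have e4 := congrArg (fun Z => trace (Y * Z)) h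
    simp only [Matrix.mul_add, trace_add] at e1 e2 e3 e4
    have hPQ : trace (P * P) = trace (Q * Q) := by
      rw [hP, hQ, Matrix.mul_assoc, trace_mul_comm, Matrix.mul_assoc, Matrix.mul_assoc,
        Matrix.mul_assoc]
    have hXY : trace (X * X) = trace (Y * Y) := by
      rw [hX, hY, htr, htr, vecMulVec_mulVec, vecMulVec_mulVec]
      simp [h0]
    have h1 : trace (P * X) = star (B *ᵥ x) ⬝ᵥ B *ᵥ x := by rw [hX, htr, hP, hq]
    have h2 : trace (Q * Y) = star (Bᴴ *ᵥ y) ⬝ᵥ Bᴴ *ᵥ y := by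
      rw [hY, htr, ← hq, conjTranspose_conjTranspose]
    rw [← h1, ← h2]
    rw [trace_mul_comm Q P] at e2
    rw [trace_mul_comm X P, trace_mul_comm X Q] at e3
    rw [trace_mul_comm Y P, trace_mul_comm Y Q, trace_mul_comm Y X] at e4
    linear_combination (e1 + e2 + e3 + e4 - hPQ - hXY) / 2

/-- Kernel vectors of the block matrix are determined by their lower half, which `X` kills. -/
theorem card_add_rank_le_rank_fromBlocks (B X : Matrix n n ℂ) :
    Fintype.card n + X.rank ≤ (fromBlocks 1 B Bᴴ (Bᴴ * B + X)).rank := by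
  set M := fromBlocks 1 B Bᴴ (Bᴴ * B + X) with hM
  have hker : ∀ v ∈ LinearMap.ker M.mulVecLin, v ∘ Sum.inl = - (B *ᵥ (v ∘ Sum.inr)) ∧
      X *ᵥ (v ∘ Sum.inr) = 0 := fun v hv => by
    rw [LinearMap.mem_ker, mulVecLin_apply, hM, fromBlocks_mulVec] at hv
    have h1 : v ∘ Sum.inl = - (B *ᵥ (v ∘ Sum.inr)) := by
      rw [eq_neg_iff_add_eq_zero]
      ext i
      simpa using congrFun hv (Sum.inl i)
    refine ⟨h1, ?_⟩
    have h2 : Bᴴ *ᵥ (v ∘ Sum.inl) + (Bᴴ * B + X) *ᵥ (v ∘ Sum.inr) = 0 := by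
      ext i
      simpa using congrFun hv (Sum.inr i)
    rw [h1, mulVec_neg, add_mulVec, ← mulVec_mulVec] at h2
    simpa using h2
  let ψ : LinearMap.ker M.mulVecLin →ₗ[ℂ] LinearMap.ker X.mulVecLin :=
    (LinearMap.funLeft ℂ ℂ (Sum.inr : n → n ⊕ n)).restrict fun v hv => by
      rw [LinearMap.mem_ker, mulVecLin_apply]
      exact (hker v hv).2
  have hψ : Function.Injective ψ := by
    rw [← LinearMap.ker_eq_bot, LinearMap.ker_eq_bot']
    intro v hv
    have h2 : (v : n ⊕ n → ℂ) ∘ Sum.inr = 0 := congrArg Subtype.val hv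
    have h1 := (hker v v.2).1
    rw [h2, mulVec_zero, neg_zero] at h1
    ext (i | i)
    · exact congrFun h1 i
    · exact congrFun h2 i
  have h1 := LinearMap.finrank_le_finrank_of_injective hψ
  have h2 := LinearMap.finrank_range_add_finrank_ker M.mulVecLin
  have h3 := LinearMap.finrank_range_add_finrank_ker X.mulVecLin
  rw [Module.finrank_pi, ← Matrix.rank] at h2 h3
  rw [Fintype.card_sum] at h2
  omega

omit [DecidableEq n] in
theorem exists_eq_vecMulVec_of_rank_eq_one {X : Matrix n n ℂ} (hX : X.PosSemidef)
    (h : X.rank = 1) : ∃ x, X = vecMulVec x (star x) := by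
  obtain ⟨V, hV⟩ := hX.exists_eq_mul_conjTranspose
  refine ⟨fun i => V i (Fin.cast h.symm 0), ?_⟩
  ext i j
  conv_lhs => rw [hV]
  rw [mul_apply, ← (finCongr h.symm).sum_comp, Fin.sum_univ_one]
  rfl

omit [DecidableEq n] in
theorem rank_pos_of_ne_zero {X : Matrix n n ℂ} (hX : X.PosSemidef) (h : X ≠ 0) : 0 < X.rank := by
  refine Nat.pos_of_ne_zero fun h0 => h ?_
  obtain ⟨V, hV⟩ := hX.exists_eq_mul_conjTranspose
  have : IsEmpty (Fin X.rank) := by rw [h0]; infer_instance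
  ext i j
  conv_lhs => rw [hV]
  simp [mul_apply]

theorem mem_sepCone_of_normal {B X : Matrix n n ℂ} (hB : Bᴴ * B = B * Bᴴ) (hX : X.PosSemidef) :
    fromBlocks 1 B Bᴴ (Bᴴ * B + X) ∈ sepCone n := by
  have : fromBlocks 1 B Bᴴ (Bᴴ * B + X) = fromBlocks 1 B Bᴴ (Bᴴ * B) + fromBlocks 0 0 0 X := by
    simp [fromBlocks_add]
  rw [this]
  exact add_mem (fromBlocks_mem_sepCone_of_normal hB) (fromBlocks_zero_mem_sepCone hX)

/-- The hypotheses say exactly that the matrix `N` with blocks `B`, `y`, `xᴴ`, `c` is normal. The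
compression of the block matrix of `N` to the original space is the given one. -/
theorem mem_sepCone_of_normal_dilation {B : Matrix n n ℂ} {x y : n → ℂ} (c : ℂ)
    (h : Bᴴ * B + vecMulVec x (star x) = B * Bᴴ + vecMulVec y (star y))
    (hxy : star x ⬝ᵥ x = star y ⬝ᵥ y)
    (hc : Bᴴ *ᵥ y + c • x = B *ᵥ x + star c • y) :
    fromBlocks 1 B Bᴴ (Bᴴ * B + vecMulVec x (star x)) ∈ sepCone n := by
  set N : Matrix (n ⊕ Unit) (n ⊕ Unit) ℂ :=
    fromBlocks B (replicateCol Unit y) (replicateRow Unit (star x)) (c • 1) with hN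
  have hNh : Nᴴ = fromBlocks Bᴴ (replicateCol Unit x) (replicateRow Unit (star y))
      (star c • 1) := by
    simp [hN, fromBlocks_conjTranspose]
  have hNN : Nᴴ * N = N * Nᴴ := by
    rw [hNh, hN, fromBlocks_multiply, fromBlocks_multiply]
    congr 1
    · simpa [← vecMulVec_eq] using h
    · ext i j
      simpa [← replicateCol_mulVec] using congrFun hc i
    · have hc' := congrArg star hc
      rw [star_add, star_add, star_mulVec, star_mulVec, conjTranspose_conjTranspose, star_smul,
        star_smul, star_star] at hc'
      ext i j
      simpa [← replicateRow_vecMul] using congrFun hc' j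
    · ext i j
      simp [hxy, mul_comm]
  set J : Matrix n (n ⊕ Unit) ℂ := fromCols 1 0 with hJ
  have hmem := ampliation_conj_mem_sepCone J (fromBlocks_mem_sepCone_of_normal hNN)
  have hconj : ∀ Z : Matrix (n ⊕ Unit) (n ⊕ Unit) ℂ, J * Z * Jᴴ = Z.toBlocks₁₁ := fun Z => by
    rw [← fromBlocks_toBlocks Z, hJ]
    simp [conjTranspose_fromCols_eq_fromRows_conjTranspose, fromCols_mul_fromBlocks,
      fromCols_mul_fromRows]
  rw [ampliation_conj_fromBlocks, hconj, hconj, hconj, hconj, hNh, hN, fromBlocks_multiply,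
    ← fromBlocks_one] at hmem
  have h11 : (fromBlocks (1 : Matrix n n ℂ) 0 0 (1 : Matrix Unit Unit ℂ)).toBlocks₁₁ = 1 := rfl
  rw [h11] at hmem
  simpa [← vecMulVec_eq] using hmem

/-- If `x` and `y` are dependent then `B` is normal; otherwise `B` has a normal dilation of size
four. -/
theorem mem_sepCone_of_rank_one {B : Matrix (Fin 3) (Fin 3) ℂ} {x y : Fin 3 → ℂ}
    (h : Bᴴ * B + vecMulVec x (star x) = B * Bᴴ + vecMulVec y (star y)) :
    fromBlocks 1 B Bᴴ (Bᴴ * B + vecMulVec x (star x)) ∈ sepCone (Fin 3) := by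
  obtain ⟨h0, h1, h2⟩ := gram_relations h
  have hadj : ∀ v w : Fin 3 → ℂ, star v ⬝ᵥ Bᴴ *ᵥ w = star (star w ⬝ᵥ B *ᵥ v) := fun v w => by
    rw [star_dotProduct, star_mulVec, conjTranspose_conjTranspose, ← dotProduct_mulVec]
  by_cases hne : (star x ⬝ᵥ x) ^ 2 - (star x ⬝ᵥ y) * (star y ⬝ᵥ x) = 0
  · -- Equality in the Cauchy–Schwarz inequality: `x` and `y` agree up to a phase.
    have hz : vecMulVec x (star x) = vecMulVec y (star y) := by
      set a := star x ⬝ᵥ x with ha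
      set s := star x ⬝ᵥ y with hs
      have hss : star y ⬝ᵥ x = star s := star_dotProduct y x
      have haa : star a = a := (star_dotProduct x x).symm
      have hz0 : a • y - s • x = 0 := by
        rw [← dotProduct_star_self_eq_zero]
        simp only [star_sub, star_smul, sub_dotProduct, dotProduct_sub, smul_dotProduct,
          dotProduct_smul, smul_eq_mul, haa, hss, ← ha, ← hs, ← h0]
        rw [hss] at hne
        linear_combination a * hne
      rcases eq_or_ne a 0 with h00 | h00
      · have hx : x = 0 := by
          rw [← dotProduct_star_self_eq_zero]; exact h00
        have hy : y = 0 := by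
          rw [← dotProduct_star_self_eq_zero, ← h0]; exact h00
        rw [hx, hy]
      · have hy : y = (s / a) • x := by
          rw [sub_eq_zero] at hz0
          rw [div_eq_inv_mul, ← smul_smul, ← hz0, smul_smul, inv_mul_cancel₀ h00, one_smul]
        rw [hss] at hne
        have : (s / a) * star (s / a) = 1 := by
          rw [star_div₀, haa]
          field_simp
          linear_combination -hne
        conv_rhs => rw [hy, star_smul, smul_vecMulVec, vecMulVec_smul, smul_smul, this, one_smul]
    rw [hz] at h
    exact mem_sepCone_of_normal (add_right_cancel h) (posSemidef_vecMulVec_self_star _)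
  · obtain ⟨θ, c, hθ, hc⟩ := exists_sub_smul_eq_smul_sub (p := B *ᵥ x) (q := Bᴴ *ᵥ y) h0
      (by rw [hadj, h1]) (hadj x y) h2 hne
    have hθ' : vecMulVec (θ • x) (star (θ • x)) = vecMulVec x (star x) := by
      rw [star_smul, smul_vecMulVec, vecMulVec_smul, smul_smul, mul_comm, hθ, one_smul]
    have := mem_sepCone_of_normal_dilation (B := B) (x := θ • x) (y := y) c (by rw [hθ', h])
      (by rw [star_smul, smul_dotProduct, dotProduct_smul, smul_smul, hθ, one_smul, h0]) (by
        rw [sub_eq_iff_eq_add] at hc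
        rw [hc, mulVec_smul]
        module)
    rwa [hθ'] at this

/-- With identity upper left block and small ranks, the Schur complements `X` and `Y` of the matrix
and of its partial transpose, which have equal traces, either both vanish, making `B` normal, or
both have rank one, in dimension three. -/
theorem IsPPT.mem_sepCone_of_one {N : ℕ} (hN : N ≤ 3) {B C D : Matrix (Fin N) (Fin N) ℂ}
    (hM : IsPPT (fromBlocks 1 B C D))
    (hr : (fromBlocks 1 B C D).rank ^ 2 + (fromBlocks 1 C B D).rank ^ 2 ≤ 4 * N ^ 2 + 1) :
    fromBlocks 1 B C D ∈ sepCone (Fin N) := by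
  obtain ⟨-, rfl, -, hD⟩ := isHermitian_fromBlocks_iff.mp hM.1.1
  let : Invertible (1 : Matrix (Fin N) (Fin N) ℂ) := invertibleOne
  have hX : (D - Bᴴ * B).PosSemidef := by
    simpa using (PosDef.fromBlocks₁₁ B D (PosDef.one (n := Fin N) (R := ℂ))).mp hM.1
  have hY : (D - B * Bᴴ).PosSemidef := by
    have h2 := hM.2
    rw [blockTranspose_fromBlocks] at h2
    simpa using (PosDef.fromBlocks₁₁ Bᴴ D (PosDef.one (n := Fin N) (R := ℂ))).mp
      (by simpa using h2)
  set X := D - Bᴴ * B with hXdef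
  set Y := D - B * Bᴴ with hYdef
  have hDX : D = Bᴴ * B + X := by rw [hXdef]; abel
  have hDY : D = B * Bᴴ + Y := by rw [hYdef]; abel
  have htr : X.trace = Y.trace := by
    rw [hXdef, hYdef, trace_sub, trace_sub, trace_mul_comm]
  have hXY : X = 0 ↔ Y = 0 := by
    rw [← hX.trace_eq_zero_iff, ← hY.trace_eq_zero_iff, htr]
  by_cases h0 : X = 0
  · rw [hDX]
    refine mem_sepCone_of_normal ?_ hX
    rw [h0, add_zero] at hDX
    rw [hXY.mp h0, add_zero] at hDY
    rw [← hDX, hDY]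
  · have hx := rank_pos_of_ne_zero hX h0
    have hy := rank_pos_of_ne_zero hY fun h => h0 (hXY.mpr h)
    have h1 := card_add_rank_le_rank_fromBlocks B X
    have h2 := card_add_rank_le_rank_fromBlocks Bᴴ Y
    rw [← hDX] at h1
    rw [conjTranspose_conjTranspose, ← hDY] at h2
    rw [Fintype.card_fin] at h1 h2
    obtain ⟨hN3, hx1, hy1⟩ : N = 3 ∧ X.rank = 1 ∧ Y.rank = 1 := by
      generalize X.rank = i at *
      generalize Y.rank = j at *
      generalize (fromBlocks 1 B Bᴴ D).rank = r at *
      generalize (fromBlocks 1 Bᴴ B D).rank = s at *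
      clear * - hN hr hx hy h1 h2
      have h3 := Nat.pow_le_pow_left h1 2
      have h4 := Nat.pow_le_pow_left h2 2
      have hi : i ≤ 3 := by nlinarith
      have hj : j ≤ 3 := by nlinarith
      interval_cases N <;> interval_cases i <;> interval_cases j <;> omega
    obtain ⟨x, hxX⟩ := exists_eq_vecMulVec_of_rank_eq_one hX hx1
    obtain ⟨y, hyY⟩ := exists_eq_vecMulVec_of_rank_eq_one hY hy1
    rw [hDX, hxX] at hDY
    rw [hyY] at hDY
    rw [hDX, hxX]
    subst hN3
    exact mem_sepCone_of_rank_one hDY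

/-- By induction on the dimension and on the total rank of the matrix and its partial transpose. -/
theorem IsPPT.mem_sepCone_fin {N : ℕ} (hN : N ≤ 3)
    {M : Matrix (Fin N ⊕ Fin N) (Fin N ⊕ Fin N) ℂ} (hM : IsPPT M) : M ∈ sepCone (Fin N) := by
  induction N using Nat.strong_induction_on with
  | _ N ihN =>
  induction hk : M.rank + (blockTranspose M).rank using Nat.strong_induction_on generalizing M with
  | _ k ihk =>
  subst hk
  by_cases hcard : 4 * N ^ 2 + 1 < M.rank ^ 2 + (blockTranspose M).rank ^ 2
  · obtain ⟨M₁, M₂, rfl, h₁, h₂, h₁', h₂'⟩ := hM.exists_add_eq_of_lt (by simpa using hcard)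
    exact add_mem (ihk _ h₁' h₁ rfl) (ihk _ h₂' h₂ rfl)
  obtain ⟨A, B, C, D, rfl⟩ : ∃ A B C D, M = fromBlocks A B C D :=
    ⟨_, _, _, _, (fromBlocks_toBlocks M).symm⟩
  by_cases hdet : A.det = 0
  · obtain ⟨f, hf, hAf⟩ := exists_mulVec_eq_zero_iff.mpr hdet
    refine hM.mem_sepCone_of_mulVec_eq_zero hf hAf fun k hk M hM => ?_
    rw [Fintype.card_fin] at hk
    exact ihN k hk (by omega) hM
  have hA : A.PosSemidef := hM.1.submatrix Sum.inl
  obtain ⟨S, hS⟩ : ∃ S : Matrix (Fin N) (Fin N) ℂ, A = Sᴴ * S := by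
    obtain ⟨V, hV⟩ := hA.exists_eq_mul_conjTranspose
    have hr : N = A.rank := by rw [rank_of_det_ne_zero hdet, Fintype.card_fin]
    refine ⟨(V.submatrix id (finCongr hr))ᴴ, ?_⟩
    rw [conjTranspose_conjTranspose, conjTranspose_submatrix, submatrix_mul_equiv,
      submatrix_id_id]
    exact hV
  have hSdet : IsUnit (Sᴴ).det := by
    rw [isUnit_iff_ne_zero]
    intro h0
    rw [hS, det_mul, h0, zero_mul] at hdet
    exact hdet rfl
  have hK := hM.ampliation_conj (Sᴴ)⁻¹
  have hA1 : (Sᴴ)⁻¹ * A * ((Sᴴ)⁻¹)ᴴ = 1 := by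
    rw [hS, ← Matrix.mul_assoc, nonsing_inv_mul _ hSdet, Matrix.one_mul, conjTranspose_nonsing_inv,
      conjTranspose_conjTranspose, mul_nonsing_inv]
    simpa using hSdet
  have hrank : ∀ {Z : Matrix (Fin N ⊕ Fin N) (Fin N ⊕ Fin N) ℂ},
      (ampliation (Sᴴ)⁻¹ * Z * (ampliation (Sᴴ)⁻¹)ᴴ).rank ≤ Z.rank := fun {Z} =>
    (rank_mul_le_left _ _).trans (rank_mul_le_right _ _)
  have hr1 := hrank (Z := fromBlocks A B C D)
  have hr2 := hrank (Z := fromBlocks A C B D)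
  rw [blockTranspose_fromBlocks] at hcard
  rw [ampliation_conj_fromBlocks, hA1] at hr1 hr2 hK
  have hmem := ampliation_conj_mem_sepCone Sᴴ (hK.mem_sepCone_of_one hN
    ((Nat.add_le_add (Nat.pow_le_pow_left hr1 2) (Nat.pow_le_pow_left hr2 2)).trans
      (not_lt.mp hcard)))
  rw [← hA1, ← ampliation_conj_fromBlocks] at hmem
  have hone : ampliation Sᴴ * ampliation (Sᴴ)⁻¹ = 1 := by
    rw [← ampliation_mul, mul_nonsing_inv _ hSdet, ampliation_one]
  convert hmem using 1
  have hone' := congrArg conjTranspose hone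
  rw [conjTranspose_mul, conjTranspose_one] at hone'
  calc fromBlocks A B C D = (ampliation Sᴴ * ampliation (Sᴴ)⁻¹) * fromBlocks A B C D *
        ((ampliation (Sᴴ)⁻¹)ᴴ * (ampliation Sᴴ)ᴴ) := by
        rw [hone, hone', Matrix.one_mul, Matrix.mul_one]
    _ = _ := by simp only [Matrix.mul_assoc]

end UnitBlock

/-! ### Operators on tensor products -/

open BipartiteState
open scoped Kronecker

section Operators

variable {HA HB : Type*} [NormedAddCommGroup HA] [InnerProductSpace ℂ HA]
  [NormedAddCommGroup HB] [InnerProductSpace ℂ HB]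
  {ι κ : Type*} [Fintype ι] [Fintype κ] [DecidableEq ι] [DecidableEq κ]
  (a : OrthonormalBasis ι ℂ HA) (b : OrthonormalBasis κ ℂ HB)

theorem toMatrix_tensorProduct_eq_matrixElements (ρ : HA ⊗[ℂ] HB →ₗ[ℂ] HA ⊗[ℂ] HB) :
    ρ.toMatrix (a.toBasis.tensorProduct b.toBasis) (a.toBasis.tensorProduct b.toBasis) =
      matrixElements a b ρ := by
  rw [← OrthonormalBasis.toBasis_tensorProduct]
  ext r c
  rw [LinearMap.toMatrix_apply, OrthonormalBasis.coe_toBasis_repr_apply,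
    OrthonormalBasis.repr_apply_apply, OrthonormalBasis.coe_toBasis,
    OrthonormalBasis.tensorProduct_apply', OrthonormalBasis.tensorProduct_apply']
  rfl

theorem isPositive_iff_posSemidef_matrixElements (ρ : HA ⊗[ℂ] HB →ₗ[ℂ] HA ⊗[ℂ] HB) :
    ρ.IsPositive ↔ (matrixElements a b ρ).PosSemidef := by
  have : FiniteDimensional ℂ HA := Module.Finite.of_basis a.toBasis
  have : FiniteDimensional ℂ HB := Module.Finite.of_basis b.toBasis
  rw [← toMatrix_tensorProduct_eq_matrixElements, ← OrthonormalBasis.toBasis_tensorProduct,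
    LinearMap.posSemidef_toMatrix_iff]

theorem isPositive_partialTranspose_iff (ρ : HA ⊗[ℂ] HB →ₗ[ℂ] HA ⊗[ℂ] HB) :
    (partialTranspose a b ρ).IsPositive ↔
      (of fun r c : ι × κ => matrixElements a b ρ (r.1, c.2) (c.1, r.2)).PosSemidef := by
  rw [isPositive_iff_posSemidef_matrixElements a b, ← toMatrix_tensorProduct_eq_matrixElements,
    partialTranspose, LinearMap.toMatrix_toLin]

theorem matrixElements_injective : Function.Injective (matrixElements a b) := fun ρ ω h => by
  rw [← toMatrix_tensorProduct_eq_matrixElements, ← toMatrix_tensorProduct_eq_matrixElements] at h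
  exact (LinearMap.toMatrix _ _).injective h

omit [DecidableEq ι] [DecidableEq κ] in
theorem matrixElements_add (ρ ω : HA ⊗[ℂ] HB →ₗ[ℂ] HA ⊗[ℂ] HB) :
    matrixElements a b (ρ + ω) = matrixElements a b ρ + matrixElements a b ω := by
  ext; simp [matrixElements, inner_add_right]

omit [DecidableEq ι] [DecidableEq κ] in
theorem matrixElements_sub (ρ ω : HA ⊗[ℂ] HB →ₗ[ℂ] HA ⊗[ℂ] HB) :
    matrixElements a b (ρ - ω) = matrixElements a b ρ - matrixElements a b ω := by
  ext; simp [matrixElements, inner_sub_right]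

/-- A combination of product states with nonnegative coefficients of arbitrary sum. -/
def IsConicCombination (ρ : HA ⊗[ℂ] HB →ₗ[ℂ] HA ⊗[ℂ] HB) : Prop :=
  ∃ (k : ℕ) (p : Fin k → ℝ) (σ : Fin k → HA →ₗ[ℂ] HA) (τ : Fin k → HB →ₗ[ℂ] HB),
    (∀ i, 0 ≤ p i) ∧ (∀ i, IsState (σ i)) ∧ (∀ i, IsState (τ i)) ∧
      ρ = ∑ i, (p i : ℂ) • TensorProduct.map (σ i) (τ i)

theorem IsConicCombination.zero :
    IsConicCombination (0 : HA ⊗[ℂ] HB →ₗ[ℂ] HA ⊗[ℂ] HB) :=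
  ⟨0, Fin.elim0, Fin.elim0, Fin.elim0, (Fin.elim0 ·), (Fin.elim0 ·), (Fin.elim0 ·), by simp⟩

theorem IsConicCombination.add {ρ ω : HA ⊗[ℂ] HB →ₗ[ℂ] HA ⊗[ℂ] HB}
    (hρ : IsConicCombination ρ) (hω : IsConicCombination ω) : IsConicCombination (ρ + ω) := by
  obtain ⟨k, p, σ, τ, hp, hσ, hτ, rfl⟩ := hρ
  obtain ⟨l, q, σ', τ', hq, hσ', hτ', rfl⟩ := hω
  refine ⟨k + l, Fin.append p q, Fin.append σ σ', Fin.append τ τ', ?_, ?_, ?_, ?_⟩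
  · exact Fin.addCases (by simpa using hp) (by simpa using hq)
  · exact Fin.addCases (by simpa using hσ) (by simpa using hσ')
  · exact Fin.addCases (by simpa using hτ) (by simpa using hτ')
  · simp [Fin.sum_univ_add]

theorem isState_rankOne {H : Type*} [NormedAddCommGroup H] [InnerProductSpace ℂ H]
    [FiniteDimensional ℂ H] {x : H} (hx : x ≠ 0) :
    IsState (((‖x‖ ^ 2)⁻¹ : ℂ) • (InnerProductSpace.rankOne ℂ x x).toLinearMap) := by
  constructor
  · refine LinearMap.IsPositive.smul_of_nonneg
      (InnerProductSpace.isPositive_rankOne_self x).toLinearMap ?_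
    rw [← Complex.ofReal_pow, ← Complex.ofReal_inv]
    exact_mod_cast by positivity
  · rw [map_smul, InnerProductSpace.trace_rankOne, inner_self_eq_norm_sq_to_K, smul_eq_mul]
    have : (‖x‖ : ℂ) ≠ 0 := by simpa using hx
    exact inv_mul_cancel₀ (pow_ne_zero 2 this)

theorem isConicCombination_map_rankOne [FiniteDimensional ℂ HA] [FiniteDimensional ℂ HB]
    (x : HA) (y : HB) :
    IsConicCombination (TensorProduct.map (InnerProductSpace.rankOne ℂ x x).toLinearMap
      (InnerProductSpace.rankOne ℂ y y).toLinearMap) := by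
  rcases eq_or_ne x 0 with rfl | hx
  · simpa using IsConicCombination.zero
  rcases eq_or_ne y 0 with rfl | hy
  · simpa using IsConicCombination.zero
  refine ⟨1, fun _ => ‖x‖ ^ 2 * ‖y‖ ^ 2, fun _ => _, fun _ => _, fun _ => by positivity,
    fun _ => isState_rankOne hx, fun _ => isState_rankOne hy, ?_⟩
  have hx' : (‖x‖ : ℂ) ≠ 0 := by simpa using hx
  have hy' : (‖y‖ : ℂ) ≠ 0 := by simpa using hy
  rw [Fin.sum_univ_one, TensorProduct.map_smul_left, TensorProduct.map_smul_right, smul_smul,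
    smul_smul]
  push_cast
  rw [show (‖x‖ : ℂ) ^ 2 * (‖y‖ : ℂ) ^ 2 * ((‖x‖ : ℂ) ^ 2)⁻¹ * ((‖y‖ : ℂ) ^ 2)⁻¹ = 1 by field_simp,
    one_smul]

theorem IsConicCombination.isMixtureOfProductStates [FiniteDimensional ℂ HA]
    [FiniteDimensional ℂ HB] {ρ : HA ⊗[ℂ] HB →ₗ[ℂ] HA ⊗[ℂ] HB}
    (hρ : IsConicCombination ρ) (htr : LinearMap.trace ℂ _ ρ = 1) :
    IsMixtureOfProductStates ρ := by
  obtain ⟨k, p, σ, τ, hp, hσ, hτ, rfl⟩ := hρ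
  refine ⟨k, p, σ, τ, hp, ?_, hσ, hτ, rfl⟩
  rw [map_sum] at htr
  have h1 : ∀ i, LinearMap.trace ℂ _ ((p i : ℂ) • TensorProduct.map (σ i) (τ i)) = p i :=
      fun i => by
    rw [map_smul, LinearMap.trace_tensorProduct', (hσ i).2, (hτ i).2, mul_one, smul_eq_mul, mul_one]
  simp only [h1] at htr
  exact_mod_cast htr

/-- Pairs of indices as indices of a `2 × 2` block matrix: the first component selects the block. -/
def blockEquiv {N : ℕ} (e : ι ≃ Fin 2) (f : κ ≃ Fin N) : ι × κ ≃ Fin N ⊕ Fin N :=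
  ((e.trans finTwoEquiv).prodCongr f).trans (Equiv.boolProdEquivSum (Fin N))

omit [Fintype ι] [Fintype κ] [DecidableEq ι] [DecidableEq κ] in
theorem productVec_blockEquiv {N : ℕ} (e : ι ≃ Fin 2) (f : κ ≃ Fin N) (α β : ℂ) (v : Fin N → ℂ)
    (r : ι × κ) :
    productVec α β v (blockEquiv e f r) = (if e r.1 = 0 then α else β) * v (f r.2) := by
  obtain ⟨i, k⟩ := r
  obtain h | h : e i = 0 ∨ e i = 1 := by omega
  all_goals simp [blockEquiv, productVec, h, Equiv.boolProdEquivSum, finTwoEquiv]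

omit [DecidableEq ι] [DecidableEq κ] in
theorem matrixElements_map_rankOne (ξ : ι → ℂ) (η : κ → ℂ) :
    matrixElements a b (TensorProduct.map
      (InnerProductSpace.rankOne ℂ (∑ i, ξ i • a i) (∑ i, ξ i • a i)).toLinearMap
      (InnerProductSpace.rankOne ℂ (∑ k, η k • b k) (∑ k, η k • b k)).toLinearMap) =
      vecMulVec (fun r => ξ r.1 * η r.2) (star fun r => ξ r.1 * η r.2) := by
  classical
  ext r c
  have hx : ∀ i, inner ℂ (a i) (∑ i, ξ i • a i) = ξ i := fun i =>
    a.orthonormal.inner_right_fintype ξ i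
  have hy : ∀ k, inner ℂ (b k) (∑ k, η k • b k) = η k := fun k =>
    b.orthonormal.inner_right_fintype η k
  have hx' : ∀ i, inner ℂ (∑ i, ξ i • a i) (a i) = star (ξ i) := fun i => by
    rw [← inner_conj_symm, hx]; rfl
  have hy' : ∀ k, inner ℂ (∑ k, η k • b k) (b k) = star (η k) := fun k => by
    rw [← inner_conj_symm, hy]; rfl
  simp only [matrixElements, of_apply, TensorProduct.map_tmul, ContinuousLinearMap.coe_coe,
    InnerProductSpace.rankOne_apply, TensorProduct.inner_tmul, inner_smul_right, hx, hy, hx', hy',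
    vecMulVec_apply, Pi.star_apply, star_mul']
  ring

theorem isConicCombination_of_mem_sepCone {N : ℕ} (e : ι ≃ Fin 2) (f : κ ≃ Fin N)
    {M : Matrix (Fin N ⊕ Fin N) (Fin N ⊕ Fin N) ℂ} (hM : M ∈ sepCone (Fin N))
    {ρ : HA ⊗[ℂ] HB →ₗ[ℂ] HA ⊗[ℂ] HB}
    (hρ : matrixElements a b ρ = M.submatrix (blockEquiv e f) (blockEquiv e f)) :
    IsConicCombination ρ := by
  have : FiniteDimensional ℂ HA := Module.Finite.of_basis a.toBasis
  have : FiniteDimensional ℂ HB := Module.Finite.of_basis b.toBasis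
  induction hM using AddSubmonoid.closure_induction generalizing ρ with
  | mem M h =>
    obtain ⟨α, β, v, rfl⟩ := h
    convert isConicCombination_map_rankOne (∑ i, (if e i = 0 then α else β) • a i)
      (∑ k, v (f k) • b k)
    refine matrixElements_injective a b ?_
    rw [hρ, matrixElements_map_rankOne a b (fun i => if e i = 0 then α else β) (fun k => v (f k))]
    ext r c
    simp only [productProj, submatrix_apply, vecMulVec_apply, Pi.star_apply,
      productVec_blockEquiv]
  | zero =>
    convert IsConicCombination.zero (HA := HA) (HB := HB)
    refine matrixElements_injective a b ?_
    rw [hρ]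
    ext r c
    simp [matrixElements]
  | add M M' _ _ h h' =>
    have hlin : ∀ Z, matrixElements a b (Matrix.toLin (a.toBasis.tensorProduct b.toBasis)
        (a.toBasis.tensorProduct b.toBasis) Z) = Z := fun Z => by
      rw [← toMatrix_tensorProduct_eq_matrixElements, LinearMap.toMatrix_toLin]
    convert (h (hlin _)).add (h' (hlin _))
    refine matrixElements_injective a b ?_
    rw [hρ, matrixElements_add, hlin, hlin]
    rfl

theorem isMixtureOfProductStates_of_isPositive (hι : Fintype.card ι = 2)
    (hκ : Fintype.card κ ≤ 3) {ρ : HA ⊗[ℂ] HB →ₗ[ℂ] HA ⊗[ℂ] HB} (hρ : IsState ρ)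
    (hT : (partialTranspose a b ρ).IsPositive) : IsMixtureOfProductStates ρ := by
  have : FiniteDimensional ℂ HA := Module.Finite.of_basis a.toBasis
  have : FiniteDimensional ℂ HB := Module.Finite.of_basis b.toBasis
  let e := Fintype.equivFinOfCardEq hι
  let f := Fintype.equivFin κ
  set φ := blockEquiv e f with hφ
  have hl : ∀ j, φ.symm (Sum.inl j) = (e.symm 0, f.symm j) := fun j => rfl
  have hr : ∀ j, φ.symm (Sum.inr j) = (e.symm 1, f.symm j) := fun j => rfl
  have hppt : IsPPT ((matrixElements a b ρ).submatrix φ.symm φ.symm) := by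
    refine ⟨((isPositive_iff_posSemidef_matrixElements a b ρ).mp hρ.1).submatrix _, ?_⟩
    have heq : blockTranspose ((matrixElements a b ρ).submatrix φ.symm φ.symm) =
        ((of fun r c : ι × κ => matrixElements a b ρ (r.1, c.2) (c.1, r.2)).submatrix
          φ.symm φ.symm)ᵀ := by
      ext (i | i) (j | j) <;>
        simp [blockTranspose, toBlocks₁₁, toBlocks₁₂, toBlocks₂₁, toBlocks₂₂, hl, hr]
    rw [heq]
    exact (((isPositive_partialTranspose_iff a b ρ).mp hT).submatrix φ.symm).transpose
  refine IsConicCombination.isMixtureOfProductStates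
    (isConicCombination_of_mem_sepCone a b e f (hppt.mem_sepCone_fin hκ) ?_) hρ.2
  ext r c
  simp [← hφ]

/-- The trace norm dominates the operator norm, by the triangle inequality in an eigenbasis
of `T† T`. -/
theorem norm_apply_le_traceNorm_mul_norm {H : Type*} [NormedAddCommGroup H]
    [InnerProductSpace ℂ H] [FiniteDimensional ℂ H] (T : H →ₗ[ℂ] H) (v : H) :
    ‖T v‖ ≤ traceNorm T * ‖v‖ := by
  have hS := T.isSymmetric_adjoint_comp_self
  set e := hS.eigenvectorBasis rfl
  have hnorm : ∀ i, ‖T (e i)‖ = T.singularValues i := fun i => by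
    rw [← sq_eq_sq₀ (norm_nonneg _) (T.singularValues_nonneg _), T.sq_singularValues_fin rfl,
      ← inner_self_eq_norm_sq (𝕜 := ℂ), ← LinearMap.adjoint_inner_right]
    have := hS.apply_eigenvectorBasis rfl i
    rw [LinearMap.comp_apply] at this
    rw [this, inner_smul_right, inner_self_eq_norm_sq_to_K, e.norm_eq_one i]
    simp
  have htn : traceNorm T = ∑ i : Fin (Module.finrank ℂ H), T.singularValues i := by
    rw [traceNorm, Finsupp.sum_of_support_subset _ (s := Finset.range (Module.finrank ℂ H)) _ _
      (by simp), Finset.sum_range]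
    intro i hi
    rw [Finset.mem_range]
    by_contra h
    exact Finsupp.mem_support_iff.mp hi (T.singularValues_of_finrank_le (not_lt.mp h))
  calc ‖T v‖ = ‖∑ i, inner ℂ (e i) v • T (e i)‖ := by
        conv_lhs => rw [← e.sum_repr' v]
        simp
    _ ≤ ∑ i, ‖inner ℂ (e i) v • T (e i)‖ := norm_sum_le _ _
    _ ≤ ∑ i : Fin (Module.finrank ℂ H), T.singularValues i * ‖v‖ := Finset.sum_le_sum fun i _ => by
        rw [norm_smul, hnorm, mul_comm]
        refine mul_le_mul_of_nonneg_left ?_ (T.singularValues_nonneg _)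
        simpa using norm_inner_le_norm (𝕜 := ℂ) (e i) v
    _ = traceNorm T * ‖v‖ := by rw [htn, Finset.sum_mul]

theorem IsMixtureOfProductStates.isPositive_partialTranspose
    {ρ : HA ⊗[ℂ] HB →ₗ[ℂ] HA ⊗[ℂ] HB} (hρ : IsMixtureOfProductStates ρ) :
    (partialTranspose a b ρ).IsPositive := by
  have : FiniteDimensional ℂ HA := Module.Finite.of_basis a.toBasis
  have : FiniteDimensional ℂ HB := Module.Finite.of_basis b.toBasis
  obtain ⟨k, p, σ, τ, hp, -, hσ, hτ, rfl⟩ := hρ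
  rw [isPositive_partialTranspose_iff]
  have : (of fun r c : ι × κ => matrixElements a b
      (∑ i, (p i : ℂ) • TensorProduct.map (σ i) (τ i)) (r.1, c.2) (c.1, r.2)) =
      ∑ i, (p i : ℂ) • ((σ i).toMatrix a.toBasis a.toBasis ⊗ₖ
        ((τ i).toMatrix b.toBasis b.toBasis)ᵀ) := by
    ext r c
    simp only [matrixElements, of_apply, LinearMap.sum_apply, LinearMap.smul_apply,
      TensorProduct.map_tmul, inner_sum, inner_smul_right, TensorProduct.inner_tmul,
      Matrix.sum_apply, Matrix.smul_apply, smul_eq_mul, kroneckerMap_apply, transpose_apply,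
      LinearMap.toMatrix_apply, OrthonormalBasis.coe_toBasis,
      OrthonormalBasis.coe_toBasis_repr_apply, OrthonormalBasis.repr_apply_apply]
  rw [this]
  refine posSemidef_sum _ fun i _ => PosSemidef.smul (PosSemidef.kronecker ?_ ?_) ?_
  · exact (LinearMap.posSemidef_toMatrix_iff a).mpr (hσ i).1
  · exact ((LinearMap.posSemidef_toMatrix_iff b).mpr (hτ i).1).transpose
  · exact_mod_cast hp i

theorem isPositive_partialTranspose_of_isSeparable [FiniteDimensional ℂ HA]
    [FiniteDimensional ℂ HB] {ρ : HA ⊗[ℂ] HB →ₗ[ℂ] HA ⊗[ℂ] HB} (hρ : IsSeparable ρ) :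
    (partialTranspose a b ρ).IsPositive := by
  obtain ⟨hρ, happ⟩ := hρ
  have hentry : ∀ (T : HA ⊗[ℂ] HB →ₗ[ℂ] HA ⊗[ℂ] HB) (r c : ι × κ),
      ‖matrixElements a b T r c‖ ≤ traceNorm T := fun T r c => by
    have h1 : ‖a r.1 ⊗ₜ[ℂ] b r.2‖ = 1 := by simp [TensorProduct.norm_tmul]
    have h2 : ‖a c.1 ⊗ₜ[ℂ] b c.2‖ = 1 := by simp [TensorProduct.norm_tmul]
    calc _ ≤ ‖a r.1 ⊗ₜ[ℂ] b r.2‖ * ‖T (a c.1 ⊗ₜ[ℂ] b c.2)‖ := norm_inner_le_norm _ _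
      _ ≤ _ := by
        have := norm_apply_le_traceNorm_mul_norm T (a c.1 ⊗ₜ[ℂ] b c.2)
        rwa [h2, mul_one, ← one_mul ‖T _‖, ← h1] at this
  rw [isPositive_partialTranspose_iff]
  have hherm := ((isPositive_iff_posSemidef_matrixElements a b ρ).mp hρ.1).1
  choose ω hω hωε using fun n : ℕ => happ (1 / ((n : ℝ) + 1)) (by positivity)
  have hlim : ∀ r c, Filter.Tendsto (fun n => matrixElements a b (ω n) r c) Filter.atTop
      (nhds (matrixElements a b ρ r c)) := fun r c => by
    rw [tendsto_iff_norm_sub_tendsto_zero]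
    refine squeeze_zero (fun _ => norm_nonneg _) (fun n => ?_)
      (tendsto_one_div_add_atTop_nhds_zero_nat (𝕜 := ℝ))
    rw [norm_sub_rev, ← Matrix.sub_apply, ← matrixElements_sub]
    exact (hentry _ r c).trans (hωε n).le
  refine .of_dotProduct_mulVec_nonneg ?_ fun x => ?_
  · ext r c
    have := congrFun (congrFun hherm (r.1, c.2)) (c.1, r.2)
    simpa using this
  · have hpos := fun n => ((isPositive_partialTranspose_iff a b (ω n)).mp
      (IsMixtureOfProductStates.isPositive_partialTranspose a b (hω n))).dotProduct_mulVec_nonneg x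
    refine ge_of_tendsto' (x := Filter.atTop) (f := fun n => star x ⬝ᵥ (of fun r c : ι × κ =>
      matrixElements a b (ω n) (r.1, c.2) (c.1, r.2)) *ᵥ x) ?_ hpos
    simp only [dotProduct, mulVec, of_apply]
    exact tendsto_finsetSum _ fun r _ => Filter.Tendsto.const_mul _ <|
      tendsto_finsetSum _ fun c _ => Filter.Tendsto.mul_const _ (hlim _ _)

theorem IsMixtureOfProductStates.isSeparable [FiniteDimensional ℂ HA]
    [FiniteDimensional ℂ HB] {ρ : HA ⊗[ℂ] HB →ₗ[ℂ] HA ⊗[ℂ] HB} (hρ : IsState ρ)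
    (h : IsMixtureOfProductStates ρ) : IsSeparable ρ :=
  ⟨hρ, fun ε hε => ⟨ρ, h, by
    rwa [sub_self, traceNorm, LinearMap.singularValues_zero, Finsupp.sum_zero_index]⟩⟩

end Operators

end PPT

theorem mainTheorem2 {HA HB : Type*}
    [NormedAddCommGroup HA] [InnerProductSpace ℂ HA] [FiniteDimensional ℂ HA]
    [NormedAddCommGroup HB] [InnerProductSpace ℂ HB] [FiniteDimensional ℂ HB]
    (hA : Module.finrank ℂ HA = 2)
    (hB : Module.finrank ℂ HB = 2 ∨ Module.finrank ℂ HB = 3)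
    {ι κ : Type*} [Fintype ι] [Fintype κ] [DecidableEq ι] [DecidableEq κ]
    (a : OrthonormalBasis ι ℂ HA) (b : OrthonormalBasis κ ℂ HB)
    (ρ : HA ⊗[ℂ] HB →ₗ[ℂ] HA ⊗[ℂ] HB) (hρ : BipartiteState.IsState ρ) :
    (BipartiteState.IsSeparable ρ ↔ (BipartiteState.partialTranspose a b ρ).IsPositive) ∧
    (BipartiteState.IsMixtureOfProductStates ρ ↔
      (BipartiteState.partialTranspose a b ρ).IsPositive) := by
  have hι : Fintype.card ι = 2 := by rw [← Module.finrank_eq_card_basis a.toBasis, hA]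
  have hκ : Fintype.card κ ≤ 3 := by
    rw [← Module.finrank_eq_card_basis b.toBasis]
    omega
  have hmix : (BipartiteState.partialTranspose a b ρ).IsPositive →
      BipartiteState.IsMixtureOfProductStates ρ :=
    PPT.isMixtureOfProductStates_of_isPositive a b hι hκ hρ
  exact ⟨⟨PPT.isPositive_partialTranspose_of_isSeparable a b, fun h =>
      PPT.IsMixtureOfProductStates.isSeparable hρ (hmix h)⟩,
    PPT.IsMixtureOfProductStates.isPositive_partialTranspose a b, hmix⟩
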